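/- Let $\mathbb{D}=\{z\in\mathbb{C}:|z|<1\}$, let $p>0$, let $\eta_1,\dots,\eta_n$ be distinct points of the unit circle $\partial\mathbb{D}$, and let $q_1,\dots,q_n$ be real numbers with $q_j>-p/4$ for every $j$. Set $R(z)=\prod_{j=1}^n (z-\eta_j)^{q_j}$, so that $|R(z)|=\prod_{j=1}^n|z-\eta_j|^{q_j}$ for $z\in\mathbb{D}$. For $f$ holomorphic in $\mathbb{D}$ and $0<\delta<1$ put $$\|f\|_{\mathcal N_{|R|^2,p},\delta}:=\sup_{1-\delta<s<1}\int_{\mathbb{D}}(1-|z|^2)^{p-1}\,|R(sz)|^2\,\log^+|f(sz)|\,dm(z)\in[0,\infty],$$ where $m$ is Lebesgue measure on the plane, and say that $f\in\mathcal N_{|R|^2,p}(\mathbb{D})$ if this quantity is finite for some $\delta\in(0,1)$. Then there is a finite constant $c(p,R)\ge 0$, depending only on $p$ and $R$, such that for every $f\in\mathcal N_{|R|^2,p}(\mathbb{D})$ with $|f(0)|=1$ and every $\delta\in(0,1)$, $$\sum_{a\in Z(f)}(1-|a|^2)^{1+p}\,|R(a)|^2\le c(p,R)\,\|f\|_{\mathcal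 N_{|R|^2,p},\delta},$$ where $Z(f)$ is the set of zeros of $f$ in $\mathbb{D}$, each counted with its multiplicity. -/

import Mathlib

open scoped ENNReal NNReal

namespace GeneralisedNevanlinna

noncomputable section

/-- The function `R(z) = ∏ⱼ (z - ηⱼ) ^ qⱼ` with real exponents `qⱼ`. It enters only through its
modulus, which does not depend on the branches of the powers (see `norm_R`), so principal values
are used. -/
def R {n : ℕ} (η : Fin n → ℂ) (q : Fin n → ℝ) (z : ℂ) : ℂ :=
  ∏ j, (z - η j) ^ (q j : ℂ)

/-- `|R(z)| = ∏ⱼ |z - ηⱼ| ^ qⱼ`. -/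
theorem norm_R {n : ℕ} (η : Fin n → ℂ) (q : Fin n → ℝ) (z : ℂ) :
    ‖R η q z‖ = ∏ j, ‖z - η j‖ ^ q j := by
  simp [R, norm_prod, Complex.norm_cpow_real]

/-- The "norm" of `f` for the weight `φ` and the parameter `p > 0`, with values in `[0, ∞]`:
`sup_{1 - δ < s < 1} ∫_𝔻 (1 - |z|²)^(p - 1) φ(s z) log⁺ |f(s z)|`, for the Lebesgue measure of the
plane. -/
def nevNorm (φ : ℂ → ℝ) (p δ : ℝ) (f : ℂ → ℂ) : ℝ≥0∞ :=
  ⨆ s ∈ Set.Ioo (1 - δ) 1, ∫⁻ z in Metric.ball (0 : ℂ) 1,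
    ENNReal.ofReal ((1 - ‖z‖ ^ 2) ^ (p - 1) * φ (s * z) * Real.posLog ‖f (s * z)‖)

/-- The generalised Nevanlinna class of the unit disc with weight `φ` and parameter `p > 0`. -/
def nevClass (φ : ℂ → ℝ) (p : ℝ) : Set (ℂ → ℂ) :=
  {f | DifferentiableOn ℂ f (Metric.ball 0 1) ∧ ∃ δ ∈ Set.Ioo (0 : ℝ) 1, nevNorm φ p δ f < ∞}

/-- The set of the zeros of `f` in the open unit disc. -/
def zeros (f : ℂ → ℂ) : Set ℂ :=
  {a | a ∈ Metric.ball (0 : ℂ) 1 ∧ f a = 0}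

/-- The sum of `w(a)`, for a nonnegative function `w`, over the zeros `a` of `f` in the open unit
disc, each zero counted with its multiplicity. -/
def zeroSum (f : ℂ → ℂ) (w : ℂ → ℝ) : ℝ≥0∞ :=
  ∑' a : zeros f, (analyticOrderNatAt f a : ℝ≥0∞) * ENNReal.ofReal (w a)

end

end GeneralisedNevanlinna

/-!
A Jensen-type inequality for the disc with a non-radial weight, proved by pairing `log |g|` with the
Laplacian of a test function.

Fix `0 < s < 1`, put `g(z) = f(s z)` and `t = 1 - |z|²`. In the disc, `|R(s z)|` is the modulus of
the holomorphic function `F(z) = ∏ⱼ (1 - s z conj (ηⱼ)) ^ qⱼ` (`branch`, `norm_branch`). The test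
function is `ψ = χ(t) |F|²`, where `χ` is a truncation of `t ^ (p + 1)` vanishing for small `t`
(`profile`). With `D = F' / F`,
`Δψ = 4 |F|² (χ'' |z|² - χ' - 2 χ' Re (z D) + χ |D|²)` (`laplacian_testFun`).
All terms are `O(t ^ (p - 1) |F|²)`, which is the weight of the norm. Since `t χ'' ≥ p χ'`, the
Laplacian is nonnegative for small `t` as soon as `p |z|² - t - 2 t Re (z D) ≥ 0`. Here
`-2 t Re (z D) = ∑ⱼ qⱼ τⱼ + O(t)` with `0 ≤ τⱼ ≤ 4`, and at most one `τⱼ` is not `O(t)`, because the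
`ηⱼ` are distinct. So the condition `4 qⱼ > -p` makes the Laplacian nonnegative near the circle,
uniformly in `s` and in the truncation (`exists_laplacian_testFun_bounds`).

Green's formula (`integral_mul_laplacian`) bounds a multiple of `∑ ψ(a)`, over zeros `a` of `g` with
multiplicity, by `∫ log |g| Δψ`. In that integral `log⁺ |g|` is paired with a multiple of the
weight, and `log⁻ |g|` only matters in a smaller disc `|z| < r₀`, away from the circle. There the weight is
bounded above and below, and `∫ log⁻ |g| ≤ ∫ log⁺ |g|` by Jensen's formula, as `|g(0)| = 1`.

To avoid the singularities of `log |g|`, finitely many zeros are split off,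
`g = ∏ₐ (z - a) ^ m(a) · h`, and `2 log |g|` is replaced by the smooth majorant
`∑ₐ m(a) log (|z - a|² + τ) + log (|h|² + τ)` (`smoothLog`). Its Laplacian is at least
`∑ₐ m(a) · 4 τ / (|z - a|² + τ)²`, an approximation of a sum of point masses as `τ → 0`
(`exists_tendsto_integral_laplacian_log`), while its positive part tends to `2 log⁺ |g|`. This gives
`sum_mul_le_integral_posLog`. Letting the truncation tend to zero and `s` to `1` finishes the proof.
-/

namespace GeneralisedNevanlinna

open MeasureTheory Filter Topology Set Metric Laplacian InnerProductSpace

/-! ### The Laplacian along lines -/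

/-- A diagonal second derivative is the second derivative along a line. -/
theorem fderiv_fderiv_apply_eq_of_hasDerivAt {u : ℂ → ℝ} {z v : ℂ} (hu : ContDiffAt ℝ 2 u z)
    {d : ℝ → ℝ} {A : ℝ} (hd : ∀ᶠ t : ℝ in 𝓝 0, HasDerivAt (fun t : ℝ => u (z + t * v)) (d t) t)
    (hA : HasDerivAt d A 0) : fderiv ℝ (fderiv ℝ u) z v v = A := by
  have hline : ∀ t : ℝ, HasDerivAt (fun t : ℝ => z + t * v) v t := fun t => by
    simpa using ((Complex.ofRealCLM.hasDerivAt (x := t)).mul_const v).const_add z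
  have hcont : Tendsto (fun t : ℝ => z + t * v) (𝓝 0) (𝓝 z) := by
    simpa using (hline 0).continuousAt.tendsto
  have h1 : ∀ᶠ w in 𝓝 z, DifferentiableAt ℝ u w := by
    filter_upwards [hu.eventually (by simp)] with w hw using hw.differentiableAt (by simp)
  have h2 : d =ᶠ[𝓝 0] fun t : ℝ => fderiv ℝ u (z + t * v) v := by
    filter_upwards [hd, hcont.eventually h1] with t ht1 ht2
    exact ht1.unique (ht2.hasFDerivAt.comp_hasDerivAt t (hline t))
  have h3 : DifferentiableAt ℝ (fderiv ℝ u) z :=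
    (hu.fderiv_right (m := 1) (by norm_num)).differentiableAt (by simp)
  have h4 : HasDerivAt (fun t : ℝ => fderiv ℝ u (z + t * v)) (fderiv ℝ (fderiv ℝ u) z v) 0 := by
    have h3' : HasFDerivAt (fderiv ℝ u) (fderiv ℝ (fderiv ℝ u) z) (z + (0 : ℝ) * v) := by
      simpa using h3.hasFDerivAt
    exact h3'.comp_hasDerivAt 0 (hline 0)
  have h5 := (h4.clm_apply (hasDerivAt_const (0 : ℝ) v)).congr_of_eventuallyEq h2
  simpa using (hA.unique h5).symm

theorem laplacian_eq_fderiv_fderiv (u : ℂ → ℝ) (z : ℂ) :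
    Δ u z = fderiv ℝ (fderiv ℝ u) z 1 1
      + fderiv ℝ (fderiv ℝ u) z Complex.I Complex.I := by
  rw [laplacian_eq_iteratedFDeriv_complexPlane]
  simp [iteratedFDeriv_two_apply]

/-- First and second derivatives of `|h|²` along a line, for a holomorphic `h`. The terms with `h''`
cancel when the directions `1` and `I` are added. -/
theorem hasDerivAt_normSq_line {h : ℂ → ℂ} {z : ℂ} (hh : AnalyticAt ℂ h z) (v : ℂ) :
    (∀ᶠ t : ℝ in 𝓝 0, HasDerivAt (fun t : ℝ => ‖h (z + t * v)‖ ^ 2)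
      (2 * inner ℝ (h (z + t * v)) (deriv h (z + t * v) * v)) t) ∧
    HasDerivAt (fun t : ℝ => 2 * inner ℝ (h (z + t * v)) (deriv h (z + t * v) * v))
      (2 * (inner ℝ (h z) (deriv (deriv h) z * v * v) + ‖deriv h z * v‖ ^ 2)) 0 := by
  have hline : ∀ t : ℝ, HasDerivAt (fun t : ℝ => z + t * v) v t := fun t => by
    simpa using ((Complex.ofRealCLM.hasDerivAt (x := t)).mul_const v).const_add z
  have hcont : Tendsto (fun t : ℝ => z + t * v) (𝓝 0) (𝓝 z) := by
    simpa using (hline 0).continuousAt.tendsto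
  have key : ∀ {k : ℂ → ℂ} {t : ℝ}, DifferentiableAt ℂ k (z + t * v) →
      HasDerivAt (fun t : ℝ => k (z + t * v)) (deriv k (z + t * v) * v) t := by
    intro k t hk
    exact HasDerivAt.comp (h₂ := k) t hk.hasDerivAt (hline t)
  refine ⟨?_, ?_⟩
  · filter_upwards [hcont.eventually hh.eventually_analyticAt] with t ht
    exact (key ht.differentiableAt).norm_sq
  · have hz : z + (0 : ℝ) * v = z := by simp
    have h1 := key (k := h) (t := 0) (by rw [hz]; exact hh.differentiableAt)
    have h2 := (key (k := deriv h) (t := 0)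
      (by rw [hz]; exact hh.deriv.differentiableAt)).mul_const v
    have h3 := (h1.inner ℝ h2).const_mul 2
    rw [hz] at h3
    simpa only [real_inner_self_eq_norm_sq] using h3

theorem inner_sq_add_inner_I_sq (a b : ℂ) :
    (inner ℝ a b) ^ 2 + (inner ℝ a (b * Complex.I)) ^ 2 = ‖a‖ ^ 2 * ‖b‖ ^ 2 := by
  simp only [Complex.inner, Complex.sq_norm, Complex.normSq_apply]
  simp
  ring

theorem inner_mul_inner_add_inner_I (a b c d : ℂ) :
    inner ℝ a b * inner ℝ c d + inner ℝ a (b * Complex.I) * inner ℝ c (d * Complex.I)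
      = inner ℝ (a * d) (b * c) := by
  simp only [Complex.inner]
  simp
  ring

/-- The Laplacian of `X(|h|²) |k|²` for holomorphic `h` and `k`. It serves both for the test
functions (`h = id`) and for the smoothed logarithms (`k = 1`). -/
theorem laplacian_comp_normSq_mul_normSq {h k : ℂ → ℂ} {z : ℂ} (hh : AnalyticAt ℂ h z)
    (hk : AnalyticAt ℂ k z) {X X₁ : ℝ → ℝ} {X₂ : ℝ} (hX : ContDiffAt ℝ 2 X (‖h z‖ ^ 2))
    (hX₁ : ∀ᶠ y in 𝓝 (‖h z‖ ^ 2), HasDerivAt X (X₁ y) y)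
    (hX₂ : HasDerivAt X₁ X₂ (‖h z‖ ^ 2)) :
    Δ (fun w => X (‖h w‖ ^ 2) * ‖k w‖ ^ 2) z =
      4 * (X₂ * (‖h z‖ ^ 2 * ‖deriv h z‖ ^ 2) * ‖k z‖ ^ 2
        + X₁ (‖h z‖ ^ 2) * ‖deriv h z‖ ^ 2 * ‖k z‖ ^ 2
        + 2 * X₁ (‖h z‖ ^ 2) * inner ℝ (h z * deriv k z) (deriv h z * k z)
        + X (‖h z‖ ^ 2) * ‖deriv k z‖ ^ 2) := by
  have hcd : ∀ {h : ℂ → ℂ}, AnalyticAt ℂ h z → ContDiffAt ℝ 2 (fun w => ‖h w‖ ^ 2) z := by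
    intro h hh
    exact (hh.contDiffAt.restrict_scalars ℝ).norm_sq ℝ
  have hu : ContDiffAt ℝ 2 (fun w => X (‖h w‖ ^ 2) * ‖k w‖ ^ 2) z :=
    (ContDiffAt.comp (g := X) z hX (hcd hh)).mul (hcd hk)
  have main : ∀ v : ℂ, fderiv ℝ (fderiv ℝ (fun w => X (‖h w‖ ^ 2) * ‖k w‖ ^ 2)) z v v =
      X₂ * (2 * inner ℝ (h z) (deriv h z * v)) ^ 2 * ‖k z‖ ^ 2
      + X₁ (‖h z‖ ^ 2) * (2 * (inner ℝ (h z) (deriv (deriv h) z * v * v) + ‖deriv h z * v‖ ^ 2))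
        * ‖k z‖ ^ 2
      + 2 * (X₁ (‖h z‖ ^ 2) * (2 * inner ℝ (h z) (deriv h z * v))
        * (2 * inner ℝ (k z) (deriv k z * v)))
      + X (‖h z‖ ^ 2) *
        (2 * (inner ℝ (k z) (deriv (deriv k) z * v * v) + ‖deriv k z * v‖ ^ 2)) := by
    intro v
    obtain ⟨a1, a2⟩ := hasDerivAt_normSq_line hh v
    obtain ⟨b1, b2⟩ := hasDerivAt_normSq_line hk v
    have hq : Tendsto (fun t : ℝ => ‖h (z + t * v)‖ ^ 2) (𝓝 0) (𝓝 (‖h z‖ ^ 2)) := by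
      simpa using a1.self_of_nhds.continuousAt.tendsto
    have hX₁' : ∀ᶠ t : ℝ in 𝓝 0, HasDerivAt (fun t : ℝ => X (‖h (z + t * v)‖ ^ 2))
        (X₁ (‖h (z + t * v)‖ ^ 2) *
          (2 * inner ℝ (h (z + t * v)) (deriv h (z + t * v) * v))) t := by
      filter_upwards [a1, hq.eventually hX₁] with t ht1 ht2
      exact HasDerivAt.comp (h₂ := X) t ht2 ht1
    have hz : z + (0 : ℝ) * v = z := by simp
    have hX₂' : HasDerivAt (fun t : ℝ => X₁ (‖h (z + t * v)‖ ^ 2))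
        (X₂ * (2 * inner ℝ (h z) (deriv h z * v))) 0 := by
      have := HasDerivAt.comp (h₂ := X₁) (h := fun t : ℝ => ‖h (z + t * v)‖ ^ 2) (0 : ℝ)
        (by rw [hz]; exact hX₂) a1.self_of_nhds
      rw [hz] at this
      exact this
    refine fderiv_fderiv_apply_eq_of_hasDerivAt hu
      (d := fun t : ℝ => X₁ (‖h (z + t * v)‖ ^ 2) *
          (2 * inner ℝ (h (z + t * v)) (deriv h (z + t * v) * v)) * ‖k (z + t * v)‖ ^ 2
        + X (‖h (z + t * v)‖ ^ 2) * (2 * inner ℝ (k (z + t * v)) (deriv k (z + t * v) * v))) ?_ ?_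
    · filter_upwards [hX₁', b1] with t ht1 ht2 using ht1.mul ht2
    · have := ((hX₂'.mul a2).mul b1.self_of_nhds).add (hX₁'.self_of_nhds.mul b2)
      refine this.congr_deriv ?_
      simp only [hz, Pi.mul_apply]
      ring
  rw [laplacian_eq_fderiv_fderiv, main 1, main Complex.I]
  have e1 := inner_sq_add_inner_I_sq (h z) (deriv h z)
  have e2 := inner_mul_inner_add_inner_I (h z) (deriv h z) (k z) (deriv k z)
  have e3 : ∀ a : ℂ, a * Complex.I * Complex.I = -a := fun a => by
    rw [mul_assoc, Complex.I_mul_I]; ring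
  simp only [mul_one, e3, inner_neg_right, norm_mul, Complex.norm_I]
  linear_combination (4 * X₂ * ‖k z‖ ^ 2) * e1 + 8 * X₁ (‖h z‖ ^ 2) * e2

theorem laplacian_log_normSq_add {h : ℂ → ℂ} {z : ℂ} (hh : AnalyticAt ℂ h z) {τ : ℝ}
    (hτ : 0 < τ) :
    Δ (fun w => Real.log (‖h w‖ ^ 2 + τ)) z = 4 * τ * ‖deriv h z‖ ^ 2 / (‖h z‖ ^ 2 + τ) ^ 2 := by
  have hpos : ∀ᶠ y in 𝓝 (‖h z‖ ^ 2), y + τ ≠ 0 :=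
    ((continuous_add_const τ).continuousAt.eventually_ne (by positivity))
  have h0 : ‖h z‖ ^ 2 + τ ≠ 0 := by positivity
  have := laplacian_comp_normSq_mul_normSq hh (analyticAt_const (v := (1 : ℂ)))
    (X := fun y => Real.log (y + τ)) (X₁ := fun y => (y + τ)⁻¹)
    (X₂ := -1 / (‖h z‖ ^ 2 + τ) ^ 2)
    (ContDiffAt.log (by fun_prop) h0)
    (by filter_upwards [hpos] with y hy
        simpa using ((hasDerivAt_id y).add_const τ).log hy)
    (((hasDerivAt_id (‖h z‖ ^ 2)).add_const τ).inv h0)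
  simp only [norm_one, one_pow, mul_one, deriv_const, mul_zero, inner_zero_left, add_zero,
    norm_zero] at this
  rw [this]
  field_simp
  ring

theorem contDiffAt_log_normSq_add {h : ℂ → ℂ} {z : ℂ} (hh : AnalyticAt ℂ h z) {τ : ℝ}
    (hτ : 0 < τ) : ContDiffAt ℝ 2 (fun w => Real.log (‖h w‖ ^ 2 + τ)) z :=
  ContDiffAt.log (((hh.contDiffAt.restrict_scalars ℝ).norm_sq ℝ).add contDiffAt_const)
    (by positivity)

/-! ### Green's formula -/

theorem integrable_mul_of_continuousAt_tsupport {u ψ : ℂ → ℝ} (hψ : Continuous ψ)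
    (hc : HasCompactSupport ψ) (hu : ∀ z ∈ tsupport ψ, ContinuousAt u z) :
    Integrable (fun z => u z * ψ z) := by
  refine Continuous.integrable_of_hasCompactSupport ?_ hc.mul_left
  refine continuous_of_tsupport fun z hz => ?_
  exact (hu z (tsupport_mul_subset_right hz)).mul hψ.continuousAt

/-- Two integrations by parts in a fixed direction. Only `ψ` is defined and smooth everywhere;
`u` is needed near the support of `ψ`. -/
theorem integral_mul_fderiv_fderiv {u ψ : ℂ → ℝ} (hψ : ContDiff ℝ 2 ψ)
    (hc : HasCompactSupport ψ) (hu : ∀ z ∈ tsupport ψ, ContDiffAt ℝ 2 u z) (v : ℂ) :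
    Integrable (fun z => u z * fderiv ℝ (fderiv ℝ ψ) z v v) ∧
    Integrable (fun z => fderiv ℝ (fderiv ℝ u) z v v * ψ z) ∧
    ∫ z, u z * fderiv ℝ (fderiv ℝ ψ) z v v = ∫ z, fderiv ℝ (fderiv ℝ u) z v v * ψ z := by
  set ψ₁ : ℂ → ℝ := fun z => fderiv ℝ ψ z v with hψ₁
  set u₁ : ℂ → ℝ := fun z => fderiv ℝ u z v with hu₁
  have c1 : ContDiff ℝ 1 ψ₁ := (hψ.fderiv_right (m := 1) (by norm_num)).clm_apply contDiff_const
  have s1 : tsupport ψ₁ ⊆ tsupport ψ := tsupport_fderiv_apply_subset ℝ v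
  have k1 : HasCompactSupport ψ₁ := hc.fderiv_apply ℝ v
  have k2 : HasCompactSupport (fun z => fderiv ℝ ψ₁ z v) := k1.fderiv_apply ℝ v
  have s2 : tsupport (fun z => fderiv ℝ ψ₁ z v) ⊆ tsupport ψ₁ := tsupport_fderiv_apply_subset ℝ v
  have c2 : Continuous (fun z => fderiv ℝ ψ₁ z v) :=
    (c1.continuous_fderiv (by simp)).clm_apply continuous_const
  have e1 : ∀ z, fderiv ℝ (fderiv ℝ ψ) z v v = fderiv ℝ ψ₁ z v := by
    intro z
    have hd : DifferentiableAt ℝ (fderiv ℝ ψ) z :=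
      ((hψ.fderiv_right (m := 1) (by norm_num)).differentiable (by simp)) z
    rw [hψ₁, fderiv_clm_apply hd (differentiableAt_const v)]
    simp
  have hud : ∀ z ∈ tsupport ψ, ContDiffAt ℝ 1 (fderiv ℝ u) z := fun z hz =>
    (hu z hz).fderiv_right (by norm_num)
  have e2 : ∀ z ∈ tsupport ψ, fderiv ℝ (fderiv ℝ u) z v v = fderiv ℝ u₁ z v := by
    intro z hz
    rw [hu₁, fderiv_clm_apply ((hud z hz).differentiableAt (by simp)) (differentiableAt_const v)]
    simp
  have hu1 : ∀ z ∈ tsupport ψ, ContDiffAt ℝ 1 u₁ z := fun z hz =>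
    (hud z hz).clm_apply contDiffAt_const
  have hu2 : ∀ z ∈ tsupport ψ, ContinuousAt (fun z => fderiv ℝ u₁ z v) z := fun z hz =>
    ((hu1 z hz).fderiv_right (m := 0) (by norm_num)).continuousAt.clm_apply continuousAt_const
  have e2' : (fun z => fderiv ℝ (fderiv ℝ u) z v v * ψ z) = fun z => fderiv ℝ u₁ z v * ψ z := by
    ext z
    by_cases hz : z ∈ tsupport ψ
    · rw [e2 z hz]
    · simp [image_eq_zero_of_notMem_tsupport hz]
  simp only [e1]
  rw [e2']
  have i1 : Integrable (fun z => u z * fderiv ℝ ψ₁ z v) :=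
    integrable_mul_of_continuousAt_tsupport c2 k2 fun z hz => (hu z (s1 (s2 hz))).continuousAt
  have i2 : Integrable (fun z => fderiv ℝ u₁ z v * ψ z) :=
    integrable_mul_of_continuousAt_tsupport hψ.continuous hc hu2
  have i3 : Integrable (fun z => u z * ψ₁ z) :=
    integrable_mul_of_continuousAt_tsupport c1.continuous k1 fun z hz =>
      (hu z (s1 hz)).continuousAt
  have i4 : Integrable (fun z => u₁ z * ψ₁ z) :=
    integrable_mul_of_continuousAt_tsupport c1.continuous k1 fun z hz =>
      (hu1 z (s1 hz)).continuousAt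
  have i5 : Integrable (fun z => u₁ z * ψ z) :=
    integrable_mul_of_continuousAt_tsupport hψ.continuous hc fun z hz =>
      (hu1 z hz).continuousAt
  refine ⟨i1, i2, ?_⟩
  rw [integral_mul_fderiv_eq_neg_fderiv_mul_of_integrable i4 i1 i3
    (fun z hz => (hu z (s1 hz)).differentiableAt (by simp))
    (fun z _ => c1.differentiable (by simp) z)]
  have := integral_mul_fderiv_eq_neg_fderiv_mul_of_integrable i2 i4 i5
    (fun z hz => (hu1 z hz).differentiableAt (by simp))
    (fun z _ => hψ.differentiable (by simp) z)
  rw [show (∫ z, fderiv ℝ u z v * ψ₁ z) = ∫ z, u₁ z * fderiv ℝ ψ z v from rfl, this, neg_neg]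

/-- Green's second identity against a compactly supported test function. -/
theorem integral_mul_laplacian {u ψ : ℂ → ℝ} (hψ : ContDiff ℝ 2 ψ)
    (hc : HasCompactSupport ψ) (hu : ∀ z ∈ tsupport ψ, ContDiffAt ℝ 2 u z) :
    Integrable (fun z => u z * Δ ψ z) ∧ Integrable (fun z => Δ u z * ψ z) ∧
      ∫ z, u z * Δ ψ z = ∫ z, Δ u z * ψ z := by
  obtain ⟨a1, a2, a3⟩ := integral_mul_fderiv_fderiv hψ hc hu 1
  obtain ⟨b1, b2, b3⟩ := integral_mul_fderiv_fderiv hψ hc hu Complex.I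
  simp only [laplacian_eq_fderiv_fderiv, mul_add, add_mul]
  refine ⟨a1.add b1, a2.add b2, ?_⟩
  rw [integral_add a1 b1, integral_add a2 b2, a3, b3]

/-! ### The radial profile -/

theorem hasDerivAt_max_zero_sq (x : ℝ) :
    HasDerivAt (fun x : ℝ => max x 0 ^ 2) (2 * max x 0) x := by
  rcases lt_trichotomy x 0 with hx | rfl | hx
  · have h : (fun x : ℝ => max x 0 ^ 2) =ᶠ[𝓝 x] fun _ => 0 := by
      filter_upwards [Iio_mem_nhds hx] with y hy
      simp [max_eq_right (le_of_lt (mem_Iio.1 hy))]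
    rw [max_eq_right hx.le]
    simpa using (hasDerivAt_const x (0 : ℝ)).congr_of_eventuallyEq h
  · rw [max_self, mul_zero]
    have h : (fun x : ℝ => max x 0 ^ 2) =O[𝓝 0] fun x => ‖x - 0‖ ^ 2 := by
      refine Asymptotics.IsBigO.of_bound 1 (Eventually.of_forall fun y => ?_)
      simp only [Real.norm_eq_abs, sub_zero, sq_abs, one_mul, abs_pow]
      refine sq_le_sq.2 ?_
      rw [abs_of_nonneg (le_max_right y 0)]
      exact max_le (le_abs_self y) (abs_nonneg y)
    exact (h.hasFDerivAt (by norm_num)).hasDerivAt.congr_deriv (by simp)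
  · have h : (fun x : ℝ => max x 0 ^ 2) =ᶠ[𝓝 x] fun x => x ^ 2 := by
      filter_upwards [Ioi_mem_nhds hx] with y hy
      rw [max_eq_left (le_of_lt (mem_Ioi.1 hy))]
    rw [max_eq_left hx.le]
    simpa using (hasDerivAt_pow 2 x).congr_of_eventuallyEq h

theorem hasDerivAt_max_zero_cube (x : ℝ) :
    HasDerivAt (fun x : ℝ => max x 0 ^ 3) (3 * max x 0 ^ 2) x := by
  have h : (fun x : ℝ => max x 0 ^ 3) = fun x => x * max x 0 ^ 2 := by
    ext y
    rcases le_total y 0 with hy | hy <;> simp [hy]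
    ring
  rw [h]
  refine ((hasDerivAt_id x).mul (hasDerivAt_max_zero_sq x)).congr_deriv ?_
  rcases le_total x 0 with hy | hy <;> simp [hy]
  ring

theorem contDiff_max_zero_cube : ContDiff ℝ 2 (fun x : ℝ => max x 0 ^ 3) := by
  have h2 : ContDiff ℝ 1 (fun x : ℝ => max x 0 ^ 2) := by
    rw [contDiff_one_iff_deriv]
    refine ⟨fun x => (hasDerivAt_max_zero_sq x).differentiableAt, ?_⟩
    rw [show deriv (fun x : ℝ => max x 0 ^ 2) = fun x => 2 * max x 0 from
      funext fun x => (hasDerivAt_max_zero_sq x).deriv]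
    fun_prop
  rw [show (2 : WithTop ℕ∞) = 1 + 1 by norm_num, contDiff_succ_iff_deriv]
  refine ⟨fun x => (hasDerivAt_max_zero_cube x).differentiableAt, by simp, ?_⟩
  rw [show deriv (fun x : ℝ => max x 0 ^ 3) = fun x => 3 * max x 0 ^ 2 from
      funext fun x => (hasDerivAt_max_zero_cube x).deriv]
  exact contDiff_const.mul h2

/-- A twice continuously differentiable truncation of `t ↦ t ^ (p + 1)`, vanishing for `t ≤ ε`. It
is `t ^ (p + 1)` times the increasing factor `(1 - ε / t)₊³`; the third power makes it `C²`. -/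
noncomputable def profile (p ε t : ℝ) : ℝ := max (t - ε) 0 ^ 3 * t ^ (p - 2)

/-- The derivative of `profile p ε` on `(0, ∞)`. -/
noncomputable def profile₁ (p ε t : ℝ) : ℝ :=
  3 * max (t - ε) 0 ^ 2 * t ^ (p - 2) + max (t - ε) 0 ^ 3 * ((p - 2) * t ^ (p - 3))

/-- The second derivative of `profile p ε` on `(0, ∞)`. -/
noncomputable def profile₂ (p ε t : ℝ) : ℝ :=
  6 * max (t - ε) 0 * t ^ (p - 2) + 6 * max (t - ε) 0 ^ 2 * ((p - 2) * t ^ (p - 3))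
    + max (t - ε) 0 ^ 3 * ((p - 2) * ((p - 3) * t ^ (p - 4)))

theorem profile_eq_zero {p ε t : ℝ} (h : t ≤ ε) : profile p ε t = 0 := by
  simp [profile, max_eq_right (sub_nonpos.2 h)]

theorem hasDerivAt_profile (p ε : ℝ) {t : ℝ} (ht : 0 < t) :
    HasDerivAt (profile p ε) (profile₁ p ε t) t := by
  have h1 : HasDerivAt (fun t => max (t - ε) 0 ^ 3) (3 * max (t - ε) 0 ^ 2) t :=
    (hasDerivAt_max_zero_cube (t - ε)).comp_sub_const t ε
  have h2 := Real.hasDerivAt_rpow_const (x := t) (p := p - 2) (Or.inl ht.ne')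
  rw [show p - 2 - 1 = p - 3 by ring] at h2
  exact h1.mul h2

theorem hasDerivAt_profile₁ (p ε : ℝ) {t : ℝ} (ht : 0 < t) :
    HasDerivAt (profile₁ p ε) (profile₂ p ε t) t := by
  have h1 : HasDerivAt (fun t => max (t - ε) 0 ^ 3) (3 * max (t - ε) 0 ^ 2) t :=
    (hasDerivAt_max_zero_cube (t - ε)).comp_sub_const t ε
  have h1' : HasDerivAt (fun t => max (t - ε) 0 ^ 2) (2 * max (t - ε) 0) t :=
    (hasDerivAt_max_zero_sq (t - ε)).comp_sub_const t ε
  have h2 := Real.hasDerivAt_rpow_const (x := t) (p := p - 2) (Or.inl ht.ne')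
  have h3 := Real.hasDerivAt_rpow_const (x := t) (p := p - 3) (Or.inl ht.ne')
  rw [show p - 2 - 1 = p - 3 by ring] at h2
  rw [show p - 3 - 1 = p - 4 by ring] at h3
  refine (((h1'.const_mul 3).mul h2).add (h1.mul (h3.const_mul (p - 2)))).congr_deriv ?_
  simp only [profile₂]
  ring

theorem contDiffAt_profile (p ε : ℝ) {t : ℝ} (ht : 0 < t) :
    ContDiffAt ℝ 2 (profile p ε) t := by
  have h1 : ContDiffAt ℝ 2 (fun t => max (t - ε) 0 ^ 3) t :=
    (contDiff_max_zero_cube.comp (contDiff_id.sub contDiff_const)).contDiffAt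
  exact h1.mul (Real.contDiffAt_rpow_const_of_ne ht.ne')

/-- The size constant for `profile p ε` and its derivatives. -/
noncomputable def profileBound (p : ℝ) : ℝ := p + 9 + 6 * |p - 2| + |p - 2| * |p - 3|

/-- The profile is comparable to its power model: the bounds do not depend on `ε`, and the
convexity inequality `p χ' ≤ t χ''`, an equality for `t ^ (p + 1)`, survives the truncation. -/
theorem profile_bounds {p ε t : ℝ} (hp : 0 < p) (hε : 0 ≤ ε) (ht : 0 < t) :
    0 ≤ profile p ε t ∧ profile p ε t ≤ profileBound p * t ^ (p - 1) * t ^ 2 ∧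
    0 ≤ profile₁ p ε t ∧ profile₁ p ε t ≤ profileBound p * t ^ (p - 1) * t ∧
    p * profile₁ p ε t ≤ t * profile₂ p ε t ∧
    0 ≤ profile₂ p ε t ∧ profile₂ p ε t ≤ profileBound p * t ^ (p - 1) := by
  -- all the powers of `t` are expressed through `t ^ (p - 4)`, the lowest one
  set y := t ^ (p - 4) with hy
  set m := max (t - ε) 0 with hm
  have hy0 : 0 < y := Real.rpow_pos_of_pos ht _
  have hm0 : 0 ≤ m := le_max_right _ _
  have hmt : m ≤ t := max_le (by linarith) ht.le
  have e2 : t ^ (p - 2) = y * t ^ 2 := by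
    rw [hy, ← Real.rpow_natCast, ← Real.rpow_add ht]; congr 1; push_cast; ring
  have e3 : t ^ (p - 3) = y * t := by
    conv_rhs => rw [hy, ← Real.rpow_one t, Real.rpow_one t, ← Real.rpow_add_one ht.ne']
    congr 1; ring
  have e1 : t ^ (p - 1) = y * t ^ 3 := by
    rw [hy, ← Real.rpow_natCast, ← Real.rpow_add ht]; congr 1; push_cast; ring
  have hK : p + 9 ≤ profileBound p := by
    have := mul_nonneg (abs_nonneg (p - 2)) (abs_nonneg (p - 3))
    unfold profileBound; linarith [abs_nonneg (p - 2)]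
  have a1 : profile p ε t = y * (m ^ 3 * t ^ 2) := by rw [profile, e2]; ring
  have a2 : profile₁ p ε t = y * (m ^ 2 * t * (3 * (t - m) + m + p * m)) := by
    rw [profile₁, e2, e3]; ring
  have a3 : profile₂ p ε t = y * (6 * m * t ^ 2 + 6 * (p - 2) * (m ^ 2 * t)
      + (p - 2) * (p - 3) * m ^ 3) := by rw [profile₂, e2, e3]; ring
  have hm2 : m ^ 2 ≤ t ^ 2 := by gcongr
  have hm3 : m ^ 3 ≤ t ^ 3 := by gcongr
  have c0 : 0 ≤ profile₁ p ε t := by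
    rw [a2]
    have : 0 ≤ t - m := sub_nonneg.2 hmt
    positivity
  have c1 : p * profile₁ p ε t ≤ t * profile₂ p ε t := by
    have : t * profile₂ p ε t - p * profile₁ p ε t
        = y * t * m * (6 * (t - m) ^ 2 + 3 * p * m * (t - m)) := by rw [a2, a3]; ring
    have h : 0 ≤ t - m := sub_nonneg.2 hmt
    have : 0 ≤ y * t * m * (6 * (t - m) ^ 2 + 3 * p * m * (t - m)) := by positivity
    linarith
  refine ⟨by rw [a1]; positivity, ?_, c0, ?_, c1, ?_, ?_⟩
  · rw [a1, e1]
    calc y * (m ^ 3 * t ^ 2) ≤ y * (t ^ 3 * t ^ 2) := by gcongr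
      _ = 1 * (y * t ^ 3) * t ^ 2 := by ring
      _ ≤ _ := by gcongr; linarith
  · rw [a2, e1]
    calc y * (m ^ 2 * t * (3 * (t - m) + m + p * m))
        ≤ y * (t ^ 2 * t * ((p + 9) * t)) := by gcongr; nlinarith
      _ = (p + 9) * (y * t ^ 3) * t := by ring
      _ ≤ _ := by gcongr
  · have : 0 ≤ t * profile₂ p ε t := le_trans (by positivity) c1
    exact nonneg_of_mul_nonneg_right this ht
  · rw [a3, e1]
    have b1 : 6 * m * t ^ 2 ≤ 6 * t ^ 3 := by
      nlinarith [mul_le_mul_of_nonneg_right hmt (sq_nonneg t)]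
    have b2 : 6 * (p - 2) * (m ^ 2 * t) ≤ 6 * |p - 2| * t ^ 3 := by
      calc 6 * (p - 2) * (m ^ 2 * t) ≤ 6 * |p - 2| * (t ^ 2 * t) := by
            gcongr; exact le_abs_self _
        _ = _ := by ring
    have b3 : (p - 2) * (p - 3) * m ^ 3 ≤ |p - 2| * |p - 3| * t ^ 3 := by
      rw [← abs_mul]
      gcongr; exact le_abs_self _
    calc y * (6 * m * t ^ 2 + 6 * (p - 2) * (m ^ 2 * t) + (p - 2) * (p - 3) * m ^ 3)
        ≤ y * (6 * t ^ 3 + 6 * |p - 2| * t ^ 3 + |p - 2| * |p - 3| * t ^ 3) := by gcongr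
      _ = (6 + 6 * |p - 2| + |p - 2| * |p - 3|) * (y * t ^ 3) := by ring
      _ ≤ _ := by
        gcongr
        unfold profileBound
        linarith

/-! ### A holomorphic branch of the weight -/

/-- The logarithmic derivative in `z` of the `j`-th factor `1 - s z conj (ηⱼ)`. -/
noncomputable def factorLogDeriv {n : ℕ} (η : Fin n → ℂ) (s : ℝ) (z : ℂ) (j : Fin n) : ℂ :=
  -(s * starRingEnd ℂ (η j)) / (1 - s * z * starRingEnd ℂ (η j))

/-- A holomorphic function in the unit disc with modulus `|R(s z)|`: the product
`∏ⱼ (1 - s z conj (ηⱼ)) ^ qⱼ`. -/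
noncomputable def branch {n : ℕ} (η : Fin n → ℂ) (q : Fin n → ℝ) (s : ℝ) (z : ℂ) : ℂ :=
  Complex.exp (∑ j, q j * Complex.log (1 - s * z * starRingEnd ℂ (η j)))

section Branch

variable {n : ℕ} {η : Fin n → ℂ} (q : Fin n → ℝ) {s : ℝ} {z : ℂ}

theorem norm_mul_conj_le (hη : ∀ j, ‖η j‖ = 1) (hs : s ∈ Ioo (0 : ℝ) 1) (z : ℂ)
    (j : Fin n) : ‖s * z * starRingEnd ℂ (η j)‖ ≤ ‖z‖ := by
  rw [norm_mul, norm_mul, RCLike.norm_conj, hη, mul_one, Complex.norm_real, Real.norm_eq_abs,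
    abs_of_pos hs.1]
  exact mul_le_of_le_one_left (norm_nonneg _) hs.2.le

theorem one_sub_mem_slitPlane {w : ℂ} (hw : ‖w‖ < 1) : 1 - w ∈ Complex.slitPlane := by
  left
  have := (Complex.re_le_norm w).trans_lt hw
  simp only [Complex.sub_re, Complex.one_re]
  linarith

theorem hasDerivAt_branch (hη : ∀ j, ‖η j‖ = 1) (hs : s ∈ Ioo (0 : ℝ) 1) (hz : ‖z‖ < 1) :
    HasDerivAt (branch η q s) (branch η q s z * ∑ j, q j * factorLogDeriv η s z j) z := by
  refine HasDerivAt.cexp (HasDerivAt.fun_sum fun j _ => HasDerivAt.const_mul _ ?_)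
  refine HasDerivAt.clog ?_
    (one_sub_mem_slitPlane ((norm_mul_conj_le hη hs z j).trans_lt hz))
  simpa using (((hasDerivAt_id z).const_mul (s : ℂ)).mul_const
    (starRingEnd ℂ (η j))).const_sub 1

theorem norm_branch (hη : ∀ j, ‖η j‖ = 1) (hs : s ∈ Ioo (0 : ℝ) 1) (hz : ‖z‖ < 1) :
    ‖branch η q s z‖ = ‖R η q (s * z)‖ := by
  rw [norm_R, branch, Complex.exp_sum, norm_prod]
  refine Finset.prod_congr rfl fun j _ => ?_
  have hne : 1 - s * z * starRingEnd ℂ (η j) ≠ 0 := Complex.slitPlane_ne_zero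
    (one_sub_mem_slitPlane ((norm_mul_conj_le hη hs z j).trans_lt hz))
  have h1 : ‖1 - s * z * starRingEnd ℂ (η j)‖ = ‖s * z - η j‖ := by
    have : η j * (1 - s * z * starRingEnd ℂ (η j)) = -(s * z - η j) := by
      have : η j * starRingEnd ℂ (η j) = 1 := by simp [Complex.mul_conj', hη]
      linear_combination -(s * z) * this
    rw [← norm_neg (s * z - η j), ← this, norm_mul, hη, one_mul]
  rw [← h1, Complex.norm_exp, Complex.re_ofReal_mul, Complex.log_re,
    Real.rpow_def_of_pos (norm_pos_iff.2 hne), mul_comm]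

theorem analyticAt_branch (hη : ∀ j, ‖η j‖ = 1) (hs : s ∈ Ioo (0 : ℝ) 1) (hz : ‖z‖ < 1) :
    AnalyticAt ℂ (branch η q s) z := by
  have hd : DifferentiableOn ℂ (branch η q s) (ball 0 1) := fun w hw =>
    (hasDerivAt_branch q hη hs (by simpa using hw)).differentiableAt.differentiableWithinAt
  exact hd.analyticAt (isOpen_ball.mem_nhds (by simpa using hz))

end Branch

/-! ### The test functions -/

section FactorLogDeriv

variable {n : ℕ} {η : Fin n → ℂ} {s : ℝ} {z : ℂ}

/-- The points `s z` stay away from the `ηⱼ` by at least half of `1 - |z|²`. -/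
theorem one_sub_norm_sq_le (hη : ∀ j, ‖η j‖ = 1) (hs : s ∈ Ioo (0 : ℝ) 1) (hz : ‖z‖ < 1)
    (j : Fin n) : 1 - ‖z‖ ^ 2 ≤ 2 * ‖1 - s * z * starRingEnd ℂ (η j)‖ := by
  have h1 := norm_mul_conj_le hη hs z j
  have h2 := norm_sub_norm_le (1 : ℂ) (s * z * starRingEnd ℂ (η j))
  rw [norm_one] at h2
  nlinarith [norm_nonneg z]

theorem mul_norm_factorLogDeriv_le (hη : ∀ j, ‖η j‖ = 1) (hs : s ∈ Ioo (0 : ℝ) 1)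
    (hz : ‖z‖ < 1) (j : Fin n) : (1 - ‖z‖ ^ 2) * ‖factorLogDeriv η s z j‖ ≤ 2 := by
  have hne : 0 < ‖1 - s * z * starRingEnd ℂ (η j)‖ := norm_pos_iff.2 (Complex.slitPlane_ne_zero
    (one_sub_mem_slitPlane ((norm_mul_conj_le hη hs z j).trans_lt hz)))
  have h1 := one_sub_norm_sq_le hη hs hz j
  have h2 : ‖(s : ℂ) * starRingEnd ℂ (η j)‖ ≤ 1 := by
    rw [norm_mul, RCLike.norm_conj, hη, mul_one, Complex.norm_real, Real.norm_eq_abs,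
      abs_of_pos hs.1]
    exact hs.2.le
  rw [factorLogDeriv, norm_div, norm_neg, mul_div_assoc', div_le_iff₀ hne]
  have : 0 ≤ 1 - ‖z‖ ^ 2 := by nlinarith [norm_nonneg z]
  nlinarith [norm_nonneg ((s : ℂ) * starRingEnd ℂ (η j))]

/-- The real part of `z` times a logarithmic derivative is `(1 - P) / 2` with a Poisson kernel
`P`; the left-hand side times `1 - |z|²` is therefore `1 - |z|² - τ`, with `0 ≤ τ ≤ 4`, and `τ` is
small unless `s z` is close to `ηⱼ`. -/
theorem exists_mul_re_factorLogDeriv (hη : ∀ j, ‖η j‖ = 1) (hs : s ∈ Ioo (0 : ℝ) 1)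
    (hz : ‖z‖ < 1) (j : Fin n) : ∃ τ : ℝ, 0 ≤ τ ∧ τ ≤ 4 ∧
      τ * ‖1 - s * z * starRingEnd ℂ (η j)‖ ^ 2 ≤ 1 - ‖z‖ ^ 2 ∧
      (1 - ‖z‖ ^ 2) * (2 * (z * factorLogDeriv η s z j).re) = 1 - ‖z‖ ^ 2 - τ := by
  set ω : ℂ := s * z * starRingEnd ℂ (η j) with hω
  have hωz : ‖ω‖ ≤ ‖z‖ := norm_mul_conj_le hη hs z j
  have hne : 0 < ‖1 - ω‖ := norm_pos_iff.2 (Complex.slitPlane_ne_zero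
    (one_sub_mem_slitPlane (hωz.trans_lt hz)))
  have h1 := one_sub_norm_sq_le hη hs hz j
  have h2 := norm_sub_norm_le (1 : ℂ) ω
  rw [norm_one] at h2
  have ht : 0 < 1 - ‖z‖ ^ 2 := by nlinarith [norm_nonneg z]
  have hω0 := norm_nonneg ω
  have ht' : 0 < 1 - ‖ω‖ ^ 2 := by nlinarith
  have h3 : 1 - ‖ω‖ ^ 2 ≤ 2 * ‖1 - ω‖ := by nlinarith
  refine ⟨(1 - ‖z‖ ^ 2) * (1 - ‖ω‖ ^ 2) / ‖1 - ω‖ ^ 2, by positivity, ?_, ?_, ?_⟩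
  · rw [div_le_iff₀ (by positivity)]
    calc (1 - ‖z‖ ^ 2) * (1 - ‖ω‖ ^ 2) ≤ (2 * ‖1 - ω‖) * (2 * ‖1 - ω‖) := by gcongr
      _ = 4 * ‖1 - ω‖ ^ 2 := by ring
  · rw [div_mul_cancel₀ _ (by positivity)]
    nlinarith [sq_nonneg ‖ω‖]
  · have e : z * factorLogDeriv η s z j = -ω / (1 - ω) := by
      rw [factorLogDeriv, ← hω, mul_div_assoc', hω]; ring
    have e2 : 2 * (-ω / (1 - ω)).re = 1 - (1 - ‖ω‖ ^ 2) / ‖1 - ω‖ ^ 2 := by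
      rw [eq_sub_iff_add_eq, Complex.div_re]
      simp only [Complex.sq_norm] at *
      have hN : Complex.normSq (1 - ω) ≠ 0 := by
        intro h; rw [Complex.normSq_eq_zero] at h; simp [h] at hne
      rw [← add_div, mul_div_assoc', ← add_div, div_eq_one_iff_eq hN]
      simp only [Complex.normSq_apply]
      simp
      ring
    rw [e, e2]
    ring

end FactorLogDeriv

/-- Near the boundary the first order terms are absorbed by the second order ones. Only one of the
points `ηⱼ` can be close to `s z`, and it costs at most `4 (-qⱼ) < p`. -/
theorem exists_forall_sum_re_factorLogDeriv_le {p : ℝ} (hp : 0 < p) {n : ℕ} {η : Fin n → ℂ}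
    (hη : ∀ j, ‖η j‖ = 1) (hinj : Function.Injective η) {q : Fin n → ℝ}
    (hq : ∀ j, -p / 4 < q j) :
    ∃ t₀ ∈ Ioo (0 : ℝ) 1, ∀ s ∈ Ioo (0 : ℝ) 1, ∀ z : ℂ, ‖z‖ < 1 → 1 - ‖z‖ ^ 2 ≤ t₀ →
      (1 - ‖z‖ ^ 2) * (2 * (z * ∑ j, q j * factorLogDeriv η s z j).re) ≤
        p * ‖z‖ ^ 2 - (1 - ‖z‖ ^ 2) := by
  classical
  -- the separation `σ` of the points `ηⱼ`, and the room `κ` in the hypothesis on the exponents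
  obtain ⟨σ, hσ, hσ'⟩ : ∃ σ : ℝ, 0 < σ ∧ ∀ j k, j ≠ k → σ ≤ ‖η j - η k‖ := by
    have : ∀ᶠ σ : ℝ in 𝓝[>] 0, ∀ j k, j ≠ k → σ ≤ ‖η j - η k‖ := by
      refine eventually_all.2 fun j => eventually_all.2 fun k => ?_
      by_cases hjk : j = k
      · exact Eventually.of_forall fun _ h => (h hjk).elim
      · have : 0 < ‖η j - η k‖ := norm_pos_iff.2 (sub_ne_zero.2 (hinj.ne hjk))
        filter_upwards [nhdsWithin_le_nhds (Iic_mem_nhds this)] with σ h _ using h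
    obtain ⟨σ, h1, h2⟩ := (this.and self_mem_nhdsWithin).exists
    exact ⟨σ, h2, h1⟩
  obtain ⟨κ, hκ, hκ'⟩ : ∃ κ : ℝ, 0 < κ ∧ κ < p ∧ ∀ j, 4 * -q j ≤ p - κ := by
    have : ∀ᶠ κ : ℝ in 𝓝[>] 0, κ < p ∧ ∀ j, 4 * -q j ≤ p - κ := by
      refine Filter.Eventually.and (nhdsWithin_le_nhds (Iio_mem_nhds hp))
        (eventually_all.2 fun j => ?_)
      have : 0 < p + 4 * q j := by linarith [hq j]
      filter_upwards [nhdsWithin_le_nhds (Iic_mem_nhds this)] with κ h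
      have : κ ≤ p + 4 * q j := h
      linarith
    obtain ⟨κ, h1, h2⟩ := (this.and self_mem_nhdsWithin).exists
    exact ⟨κ, h2, h1⟩
  obtain ⟨hκp, hκq⟩ := hκ'
  set Q : ℝ := ∑ j, |q j| with hQ
  have hQ0 : 0 ≤ Q := Finset.sum_nonneg fun _ _ => abs_nonneg _
  set D : ℝ := p + 1 + Q * (1 + 4 / σ ^ 2) with hD
  have hD0 : 0 < D := by positivity
  refine ⟨min (κ / D) (1 / 2), ⟨by positivity, (min_le_right _ _).trans_lt (by norm_num)⟩, ?_⟩
  intro s hs z hz ht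
  set t := 1 - ‖z‖ ^ 2 with htdef
  have ht0 : 0 < t := by nlinarith [norm_nonneg z]
  have htD : t * D ≤ κ := by
    rw [← le_div_iff₀ hD0]; exact ht.trans (min_le_left _ _)
  -- the indices `j` with `s z` within `σ / 2` of `ηⱼ`, of which there is at most one
  set close : Fin n → Prop := fun j => ‖1 - s * z * starRingEnd ℂ (η j)‖ < σ / 2 with hclose
  have hterm : ∀ j, q j * (t * (2 * (z * factorLogDeriv η s z j).re)) ≤
      t * (|q j| * (1 + 4 / σ ^ 2)) + if close j then p - κ else 0 := by
    intro j
    obtain ⟨τ, h0, h4, hτ, he⟩ := exists_mul_re_factorLogDeriv hη hs hz j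
    rw [he]
    have hb1 : q j * t ≤ |q j| * t := by gcongr; exact le_abs_self _
    have hq0 := abs_nonneg (q j)
    have hpos : 0 ≤ t * (|q j| * (4 / σ ^ 2)) := by positivity
    split_ifs with hj
    · have : -q j * τ ≤ p - κ := by
        rcases le_total (q j) 0 with hneg | hge
        · calc -q j * τ ≤ -q j * 4 := by gcongr; linarith
            _ ≤ p - κ := by linarith [hκq j]
        · nlinarith
      linarith
    · have hfar : σ / 2 ≤ ‖1 - s * z * starRingEnd ℂ (η j)‖ := not_lt.1 hj
      have h1 : τ * (σ / 2) ^ 2 ≤ t := le_trans (by gcongr) hτ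
      have h2 : τ ≤ t * (4 / σ ^ 2) := by
        rw [mul_div_assoc', le_div_iff₀ (by positivity)]; linarith
      have h3 : -q j * τ ≤ |q j| * (t * (4 / σ ^ 2)) := by
        gcongr; exact neg_le_abs _
      linarith
  have huniq : ∑ j, (if close j then p - κ else 0) ≤ p - κ := by
    rw [← Finset.sum_filter, Finset.sum_const, nsmul_eq_mul]
    have hcard : (Finset.univ.filter close).card ≤ 1 := by
      refine Finset.card_le_one.2 fun j hj k hk => ?_
      by_contra hjk
      have hj' : close j := (Finset.mem_filter.1 hj).2
      have hk' : close k := (Finset.mem_filter.1 hk).2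
      have e : ∀ j, ‖1 - s * z * starRingEnd ℂ (η j)‖ = ‖η j - s * z‖ := by
        intro j
        have : η j * (1 - s * z * starRingEnd ℂ (η j)) = η j - s * z := by
          have : η j * starRingEnd ℂ (η j) = 1 := by simp [Complex.mul_conj', hη]
          linear_combination -(s * z) * this
        rw [← this, norm_mul, hη, one_mul]
      simp only [hclose, e] at hj' hk'
      have h3 := norm_sub_le_norm_sub_add_norm_sub (η j) (s * z) (η k)
      rw [norm_sub_rev (s * z)] at h3
      linarith [hσ' j k hjk]
    have : ((Finset.univ.filter close).card : ℝ) ≤ 1 := by exact_mod_cast hcard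
    nlinarith
  have hsum : t * (2 * (z * ∑ j, q j * factorLogDeriv η s z j).re) =
      ∑ j, q j * (t * (2 * (z * factorLogDeriv η s z j).re)) := by
    rw [Finset.mul_sum, Complex.re_sum, Finset.mul_sum, Finset.mul_sum]
    refine Finset.sum_congr rfl fun j _ => ?_
    rw [show z * (q j * factorLogDeriv η s z j) = q j * (z * factorLogDeriv η s z j) by ring,
      Complex.re_ofReal_mul]
    ring
  rw [hsum]
  calc _ ≤ ∑ j, (t * (|q j| * (1 + 4 / σ ^ 2)) + if close j then p - κ else 0) :=
        Finset.sum_le_sum fun j _ => hterm j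
    _ ≤ t * (Q * (1 + 4 / σ ^ 2)) + (p - κ) := by
        rw [Finset.sum_add_distrib, ← Finset.mul_sum, ← Finset.sum_mul]
        gcongr
    _ ≤ p * ‖z‖ ^ 2 - t := by
        rw [show ‖z‖ ^ 2 = 1 - t by rw [htdef]; ring]
        have : t * D = t * (p + 1) + t * (Q * (1 + 4 / σ ^ 2)) := by rw [hD]; ring
        linarith

/-- The test function `χ(1 - |z|²) |R(s z)|²`, where `χ` is the truncated power
`profile p ε`. -/
noncomputable def testFun {n : ℕ} (η : Fin n → ℂ) (q : Fin n → ℝ) (p ε s : ℝ) (z : ℂ) : ℝ :=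
  profile p ε (1 - ‖z‖ ^ 2) * ‖R η q (s * z)‖ ^ 2

section TestFun

variable {n : ℕ} {η : Fin n → ℂ} (q : Fin n → ℝ) {p ε s : ℝ} {z : ℂ}

/-- The function `R` need not be smooth, as it uses principal powers; inside the disc the test
function can be written with the holomorphic `branch` instead. -/
theorem testFun_eventuallyEq (hη : ∀ j, ‖η j‖ = 1) (hs : s ∈ Ioo (0 : ℝ) 1) (hz : ‖z‖ < 1) :
    testFun η q p ε s =ᶠ[𝓝 z]
      fun w => profile p ε (1 - ‖w‖ ^ 2) * ‖branch η q s w‖ ^ 2 := by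
  filter_upwards [isOpen_ball.mem_nhds (show z ∈ ball (0 : ℂ) 1 by simpa using hz)] with w hw
  rw [testFun, norm_branch q hη hs (by simpa using hw)]

theorem testFun_nonneg (hp : 0 < p) (hε : 0 < ε) (z : ℂ) : 0 ≤ testFun η q p ε s z := by
  rcases le_total (1 - ‖z‖ ^ 2) ε with h | h
  · simp [testFun, profile_eq_zero h]
  · exact mul_nonneg (profile_bounds hp hε.le (hε.trans_le h)).1 (sq_nonneg _)

theorem tsupport_testFun_subset : tsupport (testFun η q p ε s) ⊆ {z | ε ≤ 1 - ‖z‖ ^ 2} := by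
  refine closure_minimal (fun z hz => ?_) (isClosed_le continuous_const (by fun_prop))
  by_contra h
  exact hz (by simp [testFun, profile_eq_zero (not_le.1 h).le])

theorem hasCompactSupport_testFun (hε : 0 < ε) : HasCompactSupport (testFun η q p ε s) := by
  refine (isCompact_closedBall (0 : ℂ) 1).of_isClosed_subset (isClosed_tsupport _) fun z hz => ?_
  have : ε ≤ 1 - ‖z‖ ^ 2 := tsupport_testFun_subset q hz
  rw [mem_closedBall_zero_iff]
  nlinarith [norm_nonneg z]

theorem norm_lt_one_of_mem_tsupport_testFun (hε : 0 < ε)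
    (hz : z ∈ tsupport (testFun η q p ε s)) : ‖z‖ < 1 := by
  have : ε ≤ 1 - ‖z‖ ^ 2 := tsupport_testFun_subset q hz
  nlinarith [norm_nonneg z]

theorem contDiff_testFun (hη : ∀ j, ‖η j‖ = 1) (hs : s ∈ Ioo (0 : ℝ) 1) (hε : 0 < ε) :
    ContDiff ℝ 2 (testFun η q p ε s) := by
  refine contDiff_iff_contDiffAt.2 fun z => ?_
  by_cases hz : z ∈ tsupport (testFun η q p ε s)
  · have hz1 := norm_lt_one_of_mem_tsupport_testFun q hε hz
    have ht : 0 < 1 - ‖z‖ ^ 2 := by nlinarith [norm_nonneg z]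
    refine ContDiffAt.congr_of_eventuallyEq ?_ (testFun_eventuallyEq q hη hs hz1)
    refine ContDiffAt.mul (ContDiffAt.comp (g := profile p ε) z (contDiffAt_profile p ε ht) ?_) ?_
    · exact contDiffAt_const.sub (contDiffAt_id.norm_sq ℝ)
    · exact ((analyticAt_branch q hη hs hz1).contDiffAt.restrict_scalars ℝ).norm_sq ℝ
  · exact contDiffAt_const.congr_of_eventuallyEq (notMem_tsupport_iff_eventuallyEq.1 hz)

theorem laplacian_testFun (hη : ∀ j, ‖η j‖ = 1) (hs : s ∈ Ioo (0 : ℝ) 1) (hz : ‖z‖ < 1) :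
    Δ (testFun η q p ε s) z = 4 * ‖R η q (s * z)‖ ^ 2 *
      (profile₂ p ε (1 - ‖z‖ ^ 2) * ‖z‖ ^ 2 - profile₁ p ε (1 - ‖z‖ ^ 2)
        - profile₁ p ε (1 - ‖z‖ ^ 2) * (2 * (z * ∑ j, q j * factorLogDeriv η s z j).re)
        + profile p ε (1 - ‖z‖ ^ 2) * ‖∑ j, q j * factorLogDeriv η s z j‖ ^ 2) := by
  have ht : 0 < 1 - ‖z‖ ^ 2 := by nlinarith [norm_nonneg z]
  rw [(laplacian_congr_nhds (testFun_eventuallyEq q hη hs hz)).self_of_nhds]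
  have hsub : ∀ y : ℝ, HasDerivAt (fun y : ℝ => 1 - y) (-1) y := fun y =>
    (hasDerivAt_id y).const_sub 1
  have := laplacian_comp_normSq_mul_normSq (h := fun w => w) (k := branch η q s) (z := z)
    (X := fun y => profile p ε (1 - y)) (X₁ := fun y => -profile₁ p ε (1 - y))
    (X₂ := profile₂ p ε (1 - ‖z‖ ^ 2)) analyticAt_id (analyticAt_branch q hη hs hz)
    (ContDiffAt.comp (g := profile p ε) _ (contDiffAt_profile p ε ht)
      (contDiffAt_const.sub contDiffAt_id))
    (by
      have h1 : ∀ᶠ y in 𝓝 (‖z‖ ^ 2), 0 < 1 - y :=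
        (continuous_const.sub continuous_id).continuousAt.eventually (lt_mem_nhds ht)
      filter_upwards [h1] with y hy
      exact (HasDerivAt.comp (h₂ := profile p ε) y (hasDerivAt_profile p ε hy)
        (hsub y)).congr_deriv (by simp))
    ((HasDerivAt.comp (h₂ := profile₁ p ε) (‖z‖ ^ 2)
      (hasDerivAt_profile₁ p ε ht) (hsub _)).neg.congr_deriv (by simp))
  rw [this, (hasDerivAt_branch q hη hs hz).deriv, deriv_id'', norm_branch q hη hs hz |>.symm]
  set F := branch η q s z
  set D := ∑ j, q j * factorLogDeriv η s z j
  have e : inner ℝ (z * (F * D)) (1 * F) = ‖F‖ ^ 2 * (z * D).re := by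
    rw [one_mul, Complex.inner, Complex.sq_norm, ← Complex.re_ofReal_mul,
      Complex.normSq_eq_conj_mul_self]
    rw [← Complex.conj_re]
    congr 1
    simp
    ring
  rw [e, norm_mul]
  simp only [norm_one]
  ring

/-- The Laplacian of the test functions is dominated by the weight of the norm, and nonnegative
near the unit circle, uniformly in the dilation `s` and in the truncation `ε`. -/
theorem exists_laplacian_testFun_bounds (hp : 0 < p) (hη : ∀ j, ‖η j‖ = 1)
    (hinj : Function.Injective η) (hq : ∀ j, -p / 4 < q j) :
    ∃ C : ℝ, 0 < C ∧ ∃ t₀ ∈ Ioo (0 : ℝ) 1, ∀ s ∈ Ioo (0 : ℝ) 1, ∀ ε : ℝ, 0 < ε →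
      ∀ z : ℂ, ‖z‖ < 1 →
      |Δ (testFun η q p ε s) z| ≤ C * ((1 - ‖z‖ ^ 2) ^ (p - 1) * ‖R η q (s * z)‖ ^ 2) ∧
      (1 - ‖z‖ ^ 2 ≤ t₀ → 0 ≤ Δ (testFun η q p ε s) z) := by
  obtain ⟨t₀, ht₀, h₀⟩ := exists_forall_sum_re_factorLogDeriv_le hp hη hinj hq
  set Q : ℝ := ∑ j, |q j| with hQ
  have hQ0 : 0 ≤ Q := Finset.sum_nonneg fun _ _ => abs_nonneg _
  set K := profileBound p with hK
  have hK0 : 0 < K := by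
    have := mul_nonneg (abs_nonneg (p - 2)) (abs_nonneg (p - 3))
    rw [hK]; unfold profileBound; linarith [abs_nonneg (p - 2)]
  refine ⟨4 * (K * (2 + 5 * Q + 4 * Q ^ 2)), by positivity, t₀, ht₀, ?_⟩
  intro s hs ε hε z hz
  set t := 1 - ‖z‖ ^ 2 with htdef
  have ht : 0 < t := by nlinarith [norm_nonneg z]
  have ht1 : t ≤ 1 := by nlinarith [sq_nonneg ‖z‖]
  have hz2 : ‖z‖ ^ 2 = 1 - t := by rw [htdef]; ring
  obtain ⟨b1, b2, b3, b4, b5, b6, b7⟩ := profile_bounds hp hε.le ht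
  rw [laplacian_testFun q hη hs hz, ← htdef]
  set W := ‖R η q (s * z)‖ ^ 2
  have hW : 0 ≤ W := sq_nonneg _
  set D := ∑ j, q j * factorLogDeriv η s z j with hD
  set x₀ := profile p ε t
  set x₁ := profile₁ p ε t
  set x₂ := profile₂ p ε t
  set y := t ^ (p - 1) with hy
  have hy0 : 0 < y := Real.rpow_pos_of_pos ht _
  constructor
  · have hDt : t * ‖D‖ ≤ 2 * Q := by
      calc t * ‖D‖ ≤ t * ∑ j, ‖(q j : ℂ) * factorLogDeriv η s z j‖ := by
            gcongr; exact norm_sum_le _ _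
        _ = ∑ j, |q j| * (t * ‖factorLogDeriv η s z j‖) := by
            rw [Finset.mul_sum]
            refine Finset.sum_congr rfl fun j _ => ?_
            rw [norm_mul, Complex.norm_real, Real.norm_eq_abs]; ring
        _ ≤ ∑ j, |q j| * 2 := by
            gcongr with j
            exact mul_norm_factorLogDeriv_le hη hs hz j
        _ = 2 * Q := by rw [← Finset.sum_mul]; ring
    have hA : |(z * D).re| ≤ ‖D‖ := by
      refine (Complex.abs_re_le_norm _).trans ?_
      rw [norm_mul]
      exact mul_le_of_le_one_left (norm_nonneg _) hz.le
    have hE : |x₂ * ‖z‖ ^ 2 - x₁ - x₁ * (2 * (z * D).re) + x₀ * ‖D‖ ^ 2| ≤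
        y * (K * (2 + 5 * Q + 4 * Q ^ 2)) := by
      have c1 : |x₂ * ‖z‖ ^ 2| ≤ K * y := by
        rw [abs_of_nonneg (by positivity)]
        nlinarith [sq_nonneg ‖z‖]
      have c2 : |x₁| ≤ K * y := by
        rw [abs_of_nonneg b3]
        have : 0 ≤ K * y := by positivity
        nlinarith
      have c3 : |x₁ * (2 * (z * D).re)| ≤ K * y * (5 * Q) := by
        rw [abs_mul, abs_of_nonneg b3, abs_mul, abs_two]
        calc x₁ * (2 * |(z * D).re|) ≤ (K * y * t) * (2 * ‖D‖) := by gcongr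
          _ = K * y * (2 * (t * ‖D‖)) := by ring
          _ ≤ K * y * (5 * Q) := mul_le_mul_of_nonneg_left (by linarith) (by positivity)
      have c4 : |x₀ * ‖D‖ ^ 2| ≤ K * y * (4 * Q ^ 2) := by
        rw [abs_of_nonneg (by positivity)]
        calc x₀ * ‖D‖ ^ 2 ≤ (K * y * t ^ 2) * ‖D‖ ^ 2 := by gcongr
          _ = K * y * (t * ‖D‖) ^ 2 := by ring
          _ ≤ K * y * (2 * Q) ^ 2 := by gcongr
          _ = _ := by ring
      calc _ ≤ |x₂ * ‖z‖ ^ 2| + |x₁| + |x₁ * (2 * (z * D).re)| + |x₀ * ‖D‖ ^ 2| := by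
            refine (abs_add_le _ _).trans (add_le_add_left ((abs_sub _ _).trans
              (add_le_add_left (abs_sub _ _) _)) _)
        _ ≤ K * y + K * y + K * y * (5 * Q) + K * y * (4 * Q ^ 2) := by gcongr
        _ = _ := by ring
    rw [abs_mul, abs_of_nonneg (by positivity)]
    calc _ ≤ 4 * W * (y * (K * (2 + 5 * Q + 4 * Q ^ 2))) := by gcongr
      _ = _ := by ring
  · intro htt
    have h := h₀ s hs z hz htt
    rw [← htdef, ← hD] at h
    refine mul_nonneg (by positivity) ?_
    refine nonneg_of_mul_nonneg_right (a := t) ?_ ht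
    have : 0 ≤ t * (x₀ * ‖D‖ ^ 2) := by positivity
    have h2 : x₁ * (t * (2 * (z * D).re)) ≤ x₁ * (p * ‖z‖ ^ 2 - t) := by gcongr
    have h3 : p * x₁ * ‖z‖ ^ 2 ≤ t * x₂ * ‖z‖ ^ 2 := by gcongr
    linarith

end TestFun

/-! ### The Jensen inequality on discs -/

/-- Jensen's formula, where the contribution of the zeros is nonnegative. -/
theorem circleAverage_log_norm_nonneg {g : ℂ → ℂ} {r : ℝ} (hr : r ∈ Ioo (0 : ℝ) 1)
    (hg : DifferentiableOn ℂ g (ball 0 1)) (h0 : ‖g 0‖ = 1) :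
    0 ≤ Real.circleAverage (fun z => Real.log ‖g z‖) 0 r := by
  have hg0 : g 0 ≠ 0 := fun h => by simp [h] at h0
  have hsub : closedBall (0 : ℂ) |r| ⊆ ball 0 1 := by
    rw [abs_of_pos hr.1]; exact closedBall_subset_ball hr.2
  have han : AnalyticOnNhd ℂ g (closedBall 0 |r|) := (hg.analyticOnNhd isOpen_ball).mono hsub
  rw [han.circleAverage_log_norm hr.1.ne' hg0, h0, Real.log_one, add_zero]
  refine finsum_nonneg fun u => ?_
  have hD : (0 : ℤ) ≤ MeromorphicOn.divisor g (closedBall 0 |r|) u :=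
    MeromorphicOn.AnalyticOnNhd.divisor_nonneg han u
  by_cases hu : u ∈ closedBall (0 : ℂ) |r|
  · refine mul_nonneg (by exact_mod_cast hD) ?_
    rw [abs_of_pos hr.1, mem_closedBall_zero_iff] at hu
    rcases eq_or_ne u 0 with rfl | hne
    · simp
    · refine Real.log_nonneg ?_
      rw [zero_sub, norm_neg, ← div_eq_mul_inv, one_le_div (norm_pos_iff.2 hne)]
      exact hu
  · simp [Function.locallyFinsuppWithin.apply_eq_zero_of_notMem _ hu]

theorem circleAverage_nonneg_of_log_norm_le {g : ℂ → ℂ} {u : ℂ → ℝ} {r : ℝ}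
    (hr : r ∈ Ioo (0 : ℝ) 1) (hg : DifferentiableOn ℂ g (ball 0 1)) (h0 : ‖g 0‖ = 1)
    (hu : ContinuousOn u (sphere 0 r)) (hgu : ∀ z ∈ sphere (0 : ℂ) r, g z ≠ 0 →
      Real.log ‖g z‖ ≤ u z) : 0 ≤ Real.circleAverage u 0 r := by
  classical
  have hg0 : g 0 ≠ 0 := fun h => by simp [h] at h0
  have hball : AnalyticOnNhd ℂ g (ball 0 1) := hg.analyticOnNhd isOpen_ball
  have hsub : sphere (0 : ℂ) |r| ⊆ ball 0 1 := by
    rw [abs_of_pos hr.1]; exact sphere_subset_closedBall.trans (closedBall_subset_ball hr.2)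
  -- at zeros of `g` the value `log 0 = 0` is meaningless and may exceed `u`, so it is changed there
  have hz : (fun z => Real.log ‖g z‖) =ᶠ[codiscreteWithin (sphere (0 : ℂ) |r|)]
      fun z => if g z = 0 then u z else Real.log ‖g z‖ := by
    have h1 : g ⁻¹' {0}ᶜ ∈ codiscreteWithin (ball (0 : ℂ) 1) :=
      hball.preimage_zero_mem_codiscreteWithin hg0 (by simp)
        ((convex_ball (0 : ℂ) 1).isConnected (nonempty_ball.2 one_pos))
    filter_upwards [codiscreteWithin_mono hsub h1] with z hz
    rw [if_neg (show g z ≠ 0 from hz)]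
  have hi : CircleIntegrable (fun z => Real.log ‖g z‖) 0 r :=
    MeromorphicOn.circleIntegrable_log_norm (hball.mono hsub).meromorphicOn
  refine (circleAverage_log_norm_nonneg hr hg h0).trans ?_
  rw [Real.circleAverage_congr_codiscreteWithin hz hr.1.ne']
  refine Real.circleAverage_mono (hi.congr_codiscreteWithin hz) (hu.circleIntegrable hr.1.le) ?_
  intro z hzs
  rw [abs_of_pos hr.1] at hzs
  split_ifs with h
  · exact le_rfl
  · exact hgu z hzs h

/-- Integration in polar coordinates. -/
theorem setIntegral_ball_nonneg {u : ℂ → ℝ} {r : ℝ} (hu : ContinuousOn u (closedBall 0 r))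
    (h : ∀ ρ ∈ Ioo (0 : ℝ) r, 0 ≤ Real.circleAverage u 0 ρ) : 0 ≤ ∫ z in ball 0 r, u z := by
  have hsymm : ∀ p : ℝ × ℝ, Complex.polarCoord.symm p = circleMap 0 p.1 p.2 := by
    intro p
    rw [Complex.polarCoord_symm_apply, circleMap, Complex.exp_mul_I, zero_add,
      Complex.ofReal_cos, Complex.ofReal_sin]
  set S : Set (ℝ × ℝ) := Ioo 0 r ×ˢ Ioo (-Real.pi) Real.pi with hS
  have hSm : MeasurableSet S := measurableSet_Ioo.prod measurableSet_Ioo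
  have hST : S ⊆ polarCoord.target := fun p hp => ⟨hp.1.1, hp.2⟩
  have hcont : ContinuousOn (fun p : ℝ × ℝ => p.1 * u (circleMap 0 p.1 p.2))
      (Icc 0 r ×ˢ Icc (-Real.pi) Real.pi) := by
    refine continuousOn_fst.mul (hu.comp (Continuous.continuousOn ?_) ?_)
    · simp only [circleMap]; fun_prop
    · intro p hp
      simpa [abs_of_nonneg hp.1.1] using hp.1.2
  have hint : IntegrableOn (fun p : ℝ × ℝ => p.1 * u (circleMap 0 p.1 p.2)) S
      (volume.prod volume) :=
    (hcont.integrableOn_compact (isCompact_Icc.prod isCompact_Icc)).mono_set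
      (prod_mono Ioo_subset_Icc_self Ioo_subset_Icc_self)
  have key : ∫ z in ball 0 r, u z = ∫ p in S, p.1 * u (circleMap 0 p.1 p.2) := by
    rw [← integral_indicator measurableSet_ball, ← Complex.integral_comp_polarCoord_symm,
      ← inter_eq_self_of_subset_right hST, ← setIntegral_indicator hSm]
    refine setIntegral_congr_fun polarCoord.open_target.measurableSet fun p hp => ?_
    have hp1 : 0 < p.1 := hp.1
    have hmem : circleMap 0 p.1 p.2 ∈ ball (0 : ℂ) r ↔ p ∈ S := by
      rw [mem_ball_zero_iff, norm_circleMap_zero, abs_of_pos hp1]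
      exact ⟨fun h => ⟨⟨hp1, h⟩, hp.2⟩, fun h => h.1.2⟩
    simp only [hsymm, smul_eq_mul]
    by_cases hpS : p ∈ S
    · rw [indicator_of_mem (hmem.2 hpS), indicator_of_mem hpS]
    · rw [indicator_of_notMem (fun h => hpS (hmem.1 h)), indicator_of_notMem hpS, mul_zero]
  rw [key, Measure.volume_eq_prod, setIntegral_prod _ hint]
  refine setIntegral_nonneg measurableSet_Ioo fun ρ hρ => ?_
  rw [integral_const_mul]
  refine mul_nonneg hρ.1.le ?_
  have h1 := h ρ hρ
  rw [Real.circleAverage_eq_integral_add (-Real.pi), smul_eq_mul,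
    intervalIntegral.integral_comp_add_right (fun θ => u (circleMap 0 ρ θ)),
    show (0 : ℝ) + -Real.pi = -Real.pi by ring, show 2 * Real.pi + -Real.pi = Real.pi by ring,
    intervalIntegral.integral_of_le (by linarith [Real.pi_pos]),
    integral_Ioc_eq_integral_Ioo] at h1
  exact nonneg_of_mul_nonneg_right h1 (by positivity)

/-! ### Splitting off zeros -/

theorem exists_eq_pow_mul {g : ℂ → ℂ} (hg : DifferentiableOn ℂ g (ball 0 1)) {a : ℂ}
    (ha : a ∈ ball (0 : ℂ) 1) {m : ℕ} (hm : (m : ℕ∞) ≤ analyticOrderAt g a) :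
    ∃ h : ℂ → ℂ, DifferentiableOn ℂ h (ball 0 1) ∧
      ∀ z ∈ ball (0 : ℂ) 1, g z = (z - a) ^ m * h z := by
  induction m with
  | zero => exact ⟨g, hg, by simp⟩
  | succ m ih =>
    obtain ⟨h, hh, hgh⟩ := ih (le_trans (by gcongr; exact m.le_succ) hm)
    have hnhds := isOpen_ball.mem_nhds ha
    have hord : analyticOrderAt g a = m + analyticOrderAt h a := by
      have hev : g =ᶠ[𝓝 a] (fun z => (z - a) ^ m) * h := by
        filter_upwards [hnhds] with z hz using hgh z hz
      rw [analyticOrderAt_congr hev, analyticOrderAt_mul (by fun_prop) (hh.analyticAt hnhds)]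
      congr 1
      have : AnalyticAt ℂ (fun z : ℂ => (z - a) ^ m) a := by fun_prop
      exact (this.analyticOrderAt_eq_natCast).2 ⟨fun _ => 1, analyticAt_const, one_ne_zero, by simp⟩
    have hha : h a = 0 := by
      refine apply_eq_zero_of_analyticOrderAt_ne_zero fun h0 => ?_
      rw [hord, h0, add_zero] at hm
      exact absurd (by exact_mod_cast hm : m + 1 ≤ m) (by omega)
    refine ⟨dslope h a, (Complex.differentiableOn_dslope hnhds).2 hh, fun z hz => ?_⟩
    have := sub_smul_dslope h a z
    rw [hha, sub_zero, smul_eq_mul] at this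
    rw [hgh z hz, ← this]
    ring

theorem exists_eq_prod_mul {g : ℂ → ℂ} (hg : DifferentiableOn ℂ g (ball 0 1)) (m : ℂ → ℕ)
    (T : Finset ℂ) (hT : ∀ a ∈ T, a ∈ ball (0 : ℂ) 1 ∧ (m a : ℕ∞) ≤ analyticOrderAt g a) :
    ∃ h : ℂ → ℂ, DifferentiableOn ℂ h (ball 0 1) ∧
      ∀ z ∈ ball (0 : ℂ) 1, g z = (∏ a ∈ T, (z - a) ^ m a) * h z := by
  classical
  induction T using Finset.induction_on with
  | empty => exact ⟨g, hg, by simp⟩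
  | insert b T hb ih =>
    obtain ⟨h, hh, hgh⟩ := ih fun a ha => hT a (Finset.mem_insert_of_mem ha)
    obtain ⟨hb1, hbm⟩ := hT b (Finset.mem_insert_self _ _)
    have hnhds := isOpen_ball.mem_nhds hb1
    have hord : analyticOrderAt g b = analyticOrderAt h b := by
      have hev : g =ᶠ[𝓝 b] (fun z => ∏ a ∈ T, (z - a) ^ m a) * h := by
        filter_upwards [hnhds] with z hz using hgh z hz
      have han : AnalyticAt ℂ (fun z : ℂ => ∏ a ∈ T, (z - a) ^ m a) b := by fun_prop
      rw [analyticOrderAt_congr hev, analyticOrderAt_mul han (hh.analyticAt hnhds),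
        han.analyticOrderAt_eq_zero.2, zero_add]
      refine Finset.prod_ne_zero_iff.2 fun a ha => pow_ne_zero _ (sub_ne_zero.2 ?_)
      rintro rfl
      exact hb ha
    obtain ⟨k, hk, hhk⟩ := exists_eq_pow_mul hh hb1 (hord ▸ hbm)
    refine ⟨k, hk, fun z hz => ?_⟩
    rw [hgh z hz, hhk z hz, Finset.prod_insert hb]
    ring

/-! ### Point masses as limits of the Laplacians of smoothed logarithms -/

theorem integrable_inv_one_add_norm_sq_sq :
    Integrable (fun x : ℂ => ((1 + ‖x‖ ^ 2) ^ 2)⁻¹) := by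
  have := integrable_rpow_neg_one_add_norm_sq (E := ℂ) (μ := volume) (r := 4)
    (by simp [Complex.finrank_real_complex]; norm_num)
  refine this.congr (Eventually.of_forall fun x => ?_)
  have : (-4 / 2 : ℝ) = -((2 : ℕ) : ℝ) := by norm_num
  simp only [this]
  rw [Real.rpow_neg (by positivity), Real.rpow_natCast]

/-- With `τ = c⁻²`, the functions `4 τ / (|z - a|² + τ)²`, the Laplacians of `log (|z - a|² + τ)`,
are rescalings of the single integrable function `4 / (1 + |x|²)²`, so they converge to a point mass at
`a`. The value of the mass `K`, which is `4 π`, plays no role. -/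
theorem exists_tendsto_integral_laplacian_log :
    ∃ K : ℝ, 0 < K ∧ ∀ ψ : ℂ → ℝ, Integrable ψ → ∀ a : ℂ, ContinuousAt ψ a →
      Tendsto (fun c : ℝ => ∫ z, 4 * (c ^ 2)⁻¹ / (‖z - a‖ ^ 2 + (c ^ 2)⁻¹) ^ 2 * ψ z) atTop
        (𝓝 (K * ψ a)) := by
  set K₀ : ℝ := ∫ x : ℂ, ((1 + ‖x‖ ^ 2) ^ 2)⁻¹ with hK₀
  have hK₀pos : 0 < K₀ := by
    rw [hK₀, integral_pos_iff_support_of_nonneg (fun x => by positivity)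
      integrable_inv_one_add_norm_sq_sq]
    have : Function.support (fun x : ℂ => ((1 + ‖x‖ ^ 2) ^ 2)⁻¹) = univ := by
      ext x
      simp only [Function.mem_support, mem_univ, iff_true]
      positivity
    simp [this]
  refine ⟨4 * K₀, by positivity, fun ψ hψ a hψa => ?_⟩
  have hlim : Tendsto (fun x : ℂ => ‖x‖ ^ Module.finrank ℝ ℂ * (K₀⁻¹ * ((1 + ‖x‖ ^ 2) ^ 2)⁻¹))
      (Bornology.cobounded ℂ) (𝓝 0) := by
    rw [Complex.finrank_real_complex]
    have h1 : Tendsto (fun x : ℂ => K₀⁻¹ * (‖x‖ ^ 2)⁻¹) (Bornology.cobounded ℂ) (𝓝 0) := by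
      have := (tendsto_inv_atTop_zero.comp ((tendsto_pow_atTop (two_ne_zero)).comp
        (tendsto_norm_cobounded_atTop (E := ℂ)))).const_mul K₀⁻¹
      simpa using this
    refine squeeze_zero' (Eventually.of_forall fun x => by positivity) ?_ h1
    filter_upwards [Bornology.eventually_ne_cobounded (0 : ℂ)] with x hx
    have hx' : 0 < ‖x‖ := norm_pos_iff.2 hx
    rw [mul_left_comm]
    gcongr
    rw [← div_eq_mul_inv, div_le_iff₀ (by positivity), ← div_eq_inv_mul,
      le_div_iff₀ (by positivity)]
    nlinarith [sq_nonneg ‖x‖]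
  have := (tendsto_integral_comp_smul_smul_of_integrable' (μ := (volume : Measure ℂ))
    (φ := fun x => K₀⁻¹ * ((1 + ‖x‖ ^ 2) ^ 2)⁻¹) (fun x => by positivity)
    (by rw [integral_const_mul, ← hK₀, inv_mul_cancel₀ hK₀pos.ne']) hlim hψ hψa).const_mul (4 * K₀)
  refine this.congr' ?_
  filter_upwards [eventually_gt_atTop 0] with c hc
  rw [← integral_const_mul]
  congr 1
  ext z
  rw [Complex.finrank_real_complex, norm_smul, Real.norm_eq_abs, abs_of_pos hc, norm_sub_rev a z,
    smul_eq_mul]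
  field_simp
  ring

/-! ### The weighted count of zeros for a single test function -/

/-- The smooth function `log (∏ₐ (|z - a|² + τ) ^ m(a) · (|h|² + τ))`, which decreases to
`2 log |g|` as `τ → 0` when `g = ∏ₐ (z - a) ^ m(a) · h`. -/
noncomputable def smoothLog (T : Finset ℂ) (m : ℂ → ℕ) (h : ℂ → ℂ) (τ : ℝ) (z : ℂ) : ℝ :=
  Real.log ((∏ a ∈ T, (‖z - a‖ ^ 2 + τ) ^ m a) * (‖h z‖ ^ 2 + τ))

section SmoothLog

variable {T : Finset ℂ} {m : ℂ → ℕ} {h : ℂ → ℂ} {τ : ℝ}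

theorem smoothLog_eq_sum (hτ : 0 < τ) (z : ℂ) : smoothLog T m h τ z =
    ∑ a ∈ T, m a * Real.log (‖z - a‖ ^ 2 + τ) + Real.log (‖h z‖ ^ 2 + τ) := by
  have h1 : ∀ a ∈ T, (‖z - a‖ ^ 2 + τ) ^ m a ≠ 0 := fun a _ => by positivity
  rw [smoothLog, Real.log_mul (Finset.prod_ne_zero_iff.2 h1) (by positivity), Real.log_prod h1]
  simp only [Real.log_pow]

theorem two_mul_log_norm_le_smoothLog {g : ℂ → ℂ} (hτ : 0 ≤ τ) {z : ℂ}
    (hg : g z = (∏ a ∈ T, (z - a) ^ m a) * h z) (hgz : g z ≠ 0) :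
    2 * Real.log ‖g z‖ ≤ smoothLog T m h τ z := by
  have h1 : 2 * Real.log ‖g z‖ = Real.log (‖g z‖ ^ 2) := by rw [Real.log_pow]; norm_num
  rw [h1, smoothLog]
  refine Real.log_le_log (by positivity) ?_
  rw [hg, norm_mul, norm_prod, mul_pow, ← Finset.prod_pow]
  gcongr with a _
  · rw [norm_pow, ← pow_mul, mul_comm, pow_mul]
    gcongr
    linarith
  · linarith

theorem continuousOn_smoothLog (hh : ContinuousOn h (ball 0 1)) (hτ : 0 < τ) :
    ContinuousOn (smoothLog T m h τ) (ball 0 1) := by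
  refine ContinuousOn.log ?_ fun z _ => ?_
  · exact (Continuous.continuousOn (by fun_prop)).mul ((hh.norm.pow 2).add continuousOn_const)
  · have : ∀ a ∈ T, (‖z - a‖ ^ 2 + τ) ^ m a ≠ 0 := fun a _ => by positivity
    exact mul_ne_zero (Finset.prod_ne_zero_iff.2 this) (by positivity)

theorem laplacian_eq_zero_of_notMem_tsupport {ψ : ℂ → ℝ} {z : ℂ} (hz : z ∉ tsupport ψ) :
    Δ ψ z = 0 := by
  have h := (laplacian_congr_nhds (notMem_tsupport_iff_eventuallyEq.1 hz)).self_of_nhds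
  rw [h]
  exact congrFun (laplacian_const (E := ℂ) (c := (0 : ℝ))) z

/-- Green's formula for `smoothLog`; the contribution of the remaining factor `h` is nonnegative,
whatever its zeros. -/
theorem sum_integral_le_integral_smoothLog_mul_laplacian {ψ : ℂ → ℝ} (hψ : ContDiff ℝ 2 ψ)
    (hc : HasCompactSupport ψ) (hψ0 : ∀ z, 0 ≤ ψ z) (hsupp : tsupport ψ ⊆ ball 0 1)
    (hh : DifferentiableOn ℂ h (ball 0 1)) (hτ : 0 < τ) :
    Integrable (fun z => smoothLog T m h τ z * Δ ψ z) ∧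
    ∑ a ∈ T, (m a : ℝ) * ∫ z, 4 * τ / (‖z - a‖ ^ 2 + τ) ^ 2 * ψ z ≤
      ∫ z, smoothLog T m h τ z * Δ ψ z := by
  have hlin : ∀ a : ℂ, ∀ z, AnalyticAt ℂ (fun w : ℂ => w - a) z := fun a z => by fun_prop
  have hfac : ∀ a ∈ T, Integrable (fun z => m a * (Real.log (‖z - a‖ ^ 2 + τ) * Δ ψ z)) ∧
      ∫ z, m a * (Real.log (‖z - a‖ ^ 2 + τ) * Δ ψ z) =
        m a * ∫ z, 4 * τ / (‖z - a‖ ^ 2 + τ) ^ 2 * ψ z := by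
    intro a _
    obtain ⟨i1, -, i3⟩ := integral_mul_laplacian hψ hc
      (fun z _ => contDiffAt_log_normSq_add (hlin a z) hτ)
    refine ⟨i1.const_mul _, ?_⟩
    rw [integral_const_mul, i3]
    congr 2
    ext z
    rw [laplacian_log_normSq_add (hlin a z) hτ]
    simp
  have han : ∀ z ∈ tsupport ψ, AnalyticAt ℂ h z := fun z hz =>
    hh.analyticAt (isOpen_ball.mem_nhds (hsupp hz))
  obtain ⟨j1, -, j3⟩ := integral_mul_laplacian hψ hc
      (fun z hz => contDiffAt_log_normSq_add (han z hz) hτ)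
  have e : (fun z => smoothLog T m h τ z * Δ ψ z) = fun z =>
      ∑ a ∈ T, m a * (Real.log (‖z - a‖ ^ 2 + τ) * Δ ψ z)
        + Real.log (‖h z‖ ^ 2 + τ) * Δ ψ z := by
    ext z
    rw [smoothLog_eq_sum hτ, add_mul, Finset.sum_mul]
    simp only [mul_assoc]
  have hsum := integrable_finsetSum T fun a ha => (hfac a ha).1
  rw [e]
  refine ⟨hsum.add j1, ?_⟩
  rw [integral_add hsum j1, integral_finsetSum T fun a ha => (hfac a ha).1,
    Finset.sum_congr rfl fun a ha => (hfac a ha).2, j3]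
  have hrest : 0 ≤ ∫ z, Δ (fun w => Real.log (‖h w‖ ^ 2 + τ)) z * ψ z := by
    refine integral_nonneg fun z => ?_
    by_cases hz : z ∈ tsupport ψ
    · simp only [laplacian_log_normSq_add (han z hz) hτ]
      exact mul_nonneg (by positivity) (hψ0 z)
    · simp [image_eq_zero_of_notMem_tsupport hz]
  linarith

end SmoothLog

/-- The negative part of `smoothLog` is only paired with the negative part of the Laplacian, which
lives in a smaller disc, where Jensen's inequality bounds it by the positive part. -/
theorem integral_smoothLog_mul_laplacian_le {ψ w : ℂ → ℝ} {C r r₀ b B : ℝ} (hr : r < 1)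
    (hr₀ : r₀ ≤ r) (hC : 0 ≤ C) (hb : 0 < b) (hB : 0 ≤ B)
    (hsupp : tsupport ψ ⊆ ball 0 r)
    (hw : ContinuousOn w (ball 0 1)) (hw0 : ∀ z ∈ ball (0 : ℂ) 1, 0 ≤ w z)
    (hwb : ∀ z ∈ ball (0 : ℂ) r₀, b ≤ w z ∧ w z ≤ B)
    (hΔ : ∀ z ∈ ball (0 : ℂ) r, |Δ ψ z| ≤ C * w z)
    (hΔ0 : ∀ z ∈ ball (0 : ℂ) r, r₀ ≤ ‖z‖ → 0 ≤ Δ ψ z)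
    {g : ℂ → ℂ} (hg : DifferentiableOn ℂ g (ball 0 1)) (hg0 : ‖g 0‖ = 1)
    {T : Finset ℂ} {m : ℂ → ℕ} {h : ℂ → ℂ} (hh : DifferentiableOn ℂ h (ball 0 1))
    (hgh : ∀ z ∈ ball (0 : ℂ) 1, g z = (∏ a ∈ T, (z - a) ^ m a) * h z) {τ : ℝ} (hτ : 0 < τ)
    (hint : Integrable (fun z => smoothLog T m h τ z * Δ ψ z)) :
    ∫ z, smoothLog T m h τ z * Δ ψ z ≤
      C * (1 + B / b) * ∫ z in ball 0 r, w z * max 0 (smoothLog T m h τ z) := by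
  set U := smoothLog T m h τ with hU
  have hUc : ContinuousOn U (ball 0 1) := continuousOn_smoothLog hh.continuousOn hτ
  have hUpc : ContinuousOn (fun z => max 0 (U z)) (ball 0 1) := continuousOn_const.sup hUc
  have hball : ∀ {ρ : ℝ}, ρ ≤ r → closedBall (0 : ℂ) ρ ⊆ ball 0 1 := fun hρ =>
    closedBall_subset_ball (hρ.trans_lt hr)
  have hI : ∀ {ρ : ℝ} {k : ℂ → ℝ}, ρ ≤ r → ContinuousOn k (ball 0 1) →
      IntegrableOn k (ball 0 ρ) := fun {ρ k} hρ hk =>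
    ((hk.mono (hball hρ)).integrableOn_compact (isCompact_closedBall 0 ρ)).mono_set
      ball_subset_closedBall
  have hsub : ball (0 : ℂ) r₀ ⊆ ball 0 r := ball_subset_ball hr₀
  have hrestrict : ∫ z, U z * Δ ψ z = ∫ z in ball 0 r, U z * Δ ψ z := by
    refine (setIntegral_eq_integral_of_forall_compl_eq_zero fun z hz => ?_).symm
    rw [laplacian_eq_zero_of_notMem_tsupport fun h => hz (hsupp h), mul_zero]
  -- Jensen's inequality on `ball 0 r₀`
  have hJ : 0 ≤ ∫ z in ball 0 r₀, U z := by
    refine setIntegral_ball_nonneg (hUc.mono (hball hr₀)) fun ρ hρ => ?_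
    have hρ1 : ρ ∈ Ioo (0 : ℝ) 1 := ⟨hρ.1, hρ.2.trans_le (hr₀.trans hr.le)⟩
    have hsph : sphere (0 : ℂ) ρ ⊆ ball 0 1 :=
      sphere_subset_closedBall.trans (closedBall_subset_ball hρ1.2)
    have := circleAverage_nonneg_of_log_norm_le hρ1 hg hg0
      (u := fun z => (2⁻¹ : ℝ) • U z) ((hUc.mono hsph).fun_const_smul _) (fun z hz hgz => by
        have := two_mul_log_norm_le_smoothLog hτ.le (hgh z (hsph hz)) hgz
        rw [smul_eq_mul]
        linarith)
    rw [Real.circleAverage_fun_smul, smul_eq_mul] at this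
    exact nonneg_of_mul_nonneg_right this (by norm_num)
  have hneg : ∫ z in ball 0 r₀, (max 0 (U z) - U z) ≤
      b⁻¹ * ∫ z in ball 0 r, w z * max 0 (U z) := by
    rw [integral_sub (hI hr₀ hUpc) (hI hr₀ hUc)]
    have h1 : ∫ z in ball 0 r₀, max 0 (U z) ≤ ∫ z in ball 0 r₀, b⁻¹ * (w z * max 0 (U z)) := by
      refine setIntegral_mono_on (hI hr₀ hUpc) ((hI hr₀ (hw.mul hUpc)).const_mul _)
        measurableSet_ball fun z hz => ?_
      rw [← mul_assoc]
      refine le_mul_of_one_le_left (le_max_left _ _) ?_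
      rw [← div_eq_inv_mul, one_le_div hb]
      exact (hwb z hz).1
    have h2 : ∫ z in ball 0 r₀, w z * max 0 (U z) ≤ ∫ z in ball 0 r, w z * max 0 (U z) := by
      refine setIntegral_mono_set (hI le_rfl (hw.mul hUpc)) ?_ hsub.eventuallyLE
      filter_upwards [ae_restrict_mem measurableSet_ball] with z hz
      exact mul_nonneg (hw0 z (ball_subset_ball hr.le hz)) (le_max_left _ _)
    rw [integral_const_mul] at h1
    have h3 := mul_le_mul_of_nonneg_left h2 (inv_nonneg.2 hb.le)
    linarith
  have hpt : ∀ z ∈ ball (0 : ℂ) r, U z * Δ ψ z ≤ C * (w z * max 0 (U z)) +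
      (ball (0 : ℂ) r₀).indicator (fun z => C * B * (max 0 (U z) - U z)) z := by
    intro z hz
    have hCw : 0 ≤ C * w z := mul_nonneg hC (hw0 z (ball_subset_ball hr.le hz))
    have hΔz := abs_le.1 (hΔ z hz)
    have hind : 0 ≤ (ball (0 : ℂ) r₀).indicator (fun z => C * B * (max 0 (U z) - U z)) z :=
      indicator_nonneg (fun z _ => mul_nonneg (by positivity)
        (sub_nonneg.2 (le_max_right _ _))) z
    rcases le_total 0 (U z) with hUz | hUz
    · rw [max_eq_right hUz]
      nlinarith
    · rw [max_eq_left hUz, mul_zero, mul_zero, zero_add]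
      by_cases hz0 : z ∈ ball (0 : ℂ) r₀
      · rw [indicator_of_mem hz0, max_eq_left hUz]
        have : C * w z ≤ C * B := mul_le_mul_of_nonneg_left (hwb z hz0).2 hC
        nlinarith
      · refine le_trans (mul_nonpos_of_nonpos_of_nonneg hUz (hΔ0 z hz ?_)) hind
        simpa using hz0
  have hi1 : IntegrableOn (fun z => C * (w z * max 0 (U z))) (ball 0 r) :=
    (hI le_rfl (hw.mul hUpc)).const_mul _
  have hi2 : IntegrableOn ((ball (0 : ℂ) r₀).indicator
      (fun z => C * B * (max 0 (U z) - U z))) (ball 0 r) :=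
    ((hI le_rfl (hUpc.sub hUc)).const_mul _).indicator measurableSet_ball
  rw [hrestrict]
  calc ∫ z in ball 0 r, U z * Δ ψ z
      ≤ ∫ z in ball 0 r, (C * (w z * max 0 (U z)) +
          (ball (0 : ℂ) r₀).indicator (fun z => C * B * (max 0 (U z) - U z)) z) :=
        setIntegral_mono_on hint.integrableOn (hi1.add hi2) measurableSet_ball hpt
    _ = C * (∫ z in ball 0 r, w z * max 0 (U z)) +
          C * B * ∫ z in ball 0 r₀, (max 0 (U z) - U z) := by
        rw [integral_add hi1 hi2, integral_const_mul, setIntegral_indicator measurableSet_ball,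
          inter_eq_self_of_subset_right hsub, integral_const_mul]
    _ ≤ C * (∫ z in ball 0 r, w z * max 0 (U z)) +
          C * B * (b⁻¹ * ∫ z in ball 0 r, w z * max 0 (U z)) := by gcongr
    _ = _ := by ring

theorem smoothLog_le_of_le {T : Finset ℂ} {m : ℂ → ℕ} {h : ℂ → ℂ} {τ τ' : ℝ}
    (hτ : 0 < τ) (hττ' : τ ≤ τ') (z : ℂ) : smoothLog T m h τ z ≤ smoothLog T m h τ' z := by
  rw [smoothLog, smoothLog]
  have : 0 < ∏ a ∈ T, (‖z - a‖ ^ 2 + τ) ^ m a := Finset.prod_pos fun a _ => by positivity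
  refine Real.log_le_log (by positivity) ?_
  have : 0 ≤ ∏ a ∈ T, (‖z - a‖ ^ 2 + τ') ^ m a :=
    Finset.prod_nonneg fun a _ => pow_nonneg (by linarith [sq_nonneg ‖z - a‖]) _
  gcongr

theorem tendsto_max_zero_smoothLog {T : Finset ℂ} {m : ℂ → ℕ} {g h : ℂ → ℂ} {z : ℂ}
    (hg : g z = (∏ a ∈ T, (z - a) ^ m a) * h z) :
    Tendsto (fun τ => max 0 (smoothLog T m h τ z)) (𝓝 0) (𝓝 (2 * Real.posLog ‖g z‖)) := by
  have h1 : Continuous fun τ : ℝ =>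
      Real.posLog ((∏ a ∈ T, (‖z - a‖ ^ 2 + τ) ^ m a) * (‖h z‖ ^ 2 + τ)) :=
    Real.continuous_posLog.comp (by fun_prop)
  refine h1.tendsto' _ _ ?_
  have h2 : 2 * Real.posLog ‖g z‖ = Real.posLog (‖g z‖ ^ 2) := by
    rw [Real.posLog_pow]; norm_num
  rw [h2, hg, norm_mul, norm_prod, mul_pow, ← Finset.prod_pow]
  simp only [add_zero, norm_pow, ← pow_mul, mul_comm]

/-- The Jensen-type bound for a test function whose Laplacian is dominated by a weight and is
nonnegative off a smaller disc. -/
theorem sum_mul_le_integral_posLog {K : ℝ}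
    (hK : ∀ ψ : ℂ → ℝ, Integrable ψ → ∀ a : ℂ, ContinuousAt ψ a →
      Tendsto (fun c : ℝ => ∫ z, 4 * (c ^ 2)⁻¹ / (‖z - a‖ ^ 2 + (c ^ 2)⁻¹) ^ 2 * ψ z) atTop
        (𝓝 (K * ψ a)))
    {ψ w : ℂ → ℝ} {C r r₀ b B : ℝ} (hψ : ContDiff ℝ 2 ψ)
    (hc : HasCompactSupport ψ) (hψ0 : ∀ z, 0 ≤ ψ z) (hr : r < 1)
    (hr₀ : r₀ ≤ r) (hC : 0 ≤ C) (hb : 0 < b) (hB : 0 ≤ B)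
    (hsupp : tsupport ψ ⊆ ball 0 r)
    (hw : ContinuousOn w (ball 0 1)) (hw0 : ∀ z ∈ ball (0 : ℂ) 1, 0 ≤ w z)
    (hwb : ∀ z ∈ ball (0 : ℂ) r₀, b ≤ w z ∧ w z ≤ B)
    (hΔ : ∀ z ∈ ball (0 : ℂ) r, |Δ ψ z| ≤ C * w z)
    (hΔ0 : ∀ z ∈ ball (0 : ℂ) r, r₀ ≤ ‖z‖ → 0 ≤ Δ ψ z)
    {g : ℂ → ℂ} (hg : DifferentiableOn ℂ g (ball 0 1)) (hg0 : ‖g 0‖ = 1)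
    {T : Finset ℂ} {m : ℂ → ℕ}
    (hT : ∀ a ∈ T, a ∈ ball (0 : ℂ) 1 ∧ (m a : ℕ∞) ≤ analyticOrderAt g a) :
    ∑ a ∈ T, m a * (K * ψ a) ≤
      C * (1 + B / b) * ∫ z in ball 0 r, w z * (2 * Real.posLog ‖g z‖) := by
  obtain ⟨h, hh, hgh⟩ := exists_eq_prod_mul hg m T hT
  have hτ0 : Tendsto (fun c : ℝ => (c ^ 2)⁻¹) atTop (𝓝 0) :=
    tendsto_inv_atTop_zero.comp (tendsto_pow_atTop two_ne_zero)
  have hUc : ∀ {τ : ℝ}, 0 < τ →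
      ContinuousOn (fun z => w z * max 0 (smoothLog T m h τ z)) (ball 0 1) := fun hτ =>
    hw.mul (continuousOn_const.sup (continuousOn_smoothLog hh.continuousOn hτ))
  have hsub : ball (0 : ℂ) r ⊆ ball 0 1 := ball_subset_ball hr.le
  have hleft : Tendsto (fun c : ℝ => ∑ a ∈ T,
      (m a : ℝ) * ∫ z, 4 * (c ^ 2)⁻¹ / (‖z - a‖ ^ 2 + (c ^ 2)⁻¹) ^ 2 * ψ z) atTop
      (𝓝 (∑ a ∈ T, m a * (K * ψ a))) :=
    tendsto_finsetSum _ fun a _ =>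
      (hK ψ (hψ.continuous.integrable_of_hasCompactSupport hc) a
        hψ.continuous.continuousAt).const_mul _
  have hright : Tendsto (fun c : ℝ =>
      ∫ z in ball 0 r, w z * max 0 (smoothLog T m h (c ^ 2)⁻¹ z)) atTop
      (𝓝 (∫ z in ball 0 r, w z * (2 * Real.posLog ‖g z‖))) := by
    refine tendsto_integral_filter_of_dominated_convergence
      (fun z => w z * max 0 (smoothLog T m h 1 z)) ?_ ?_ ?_ ?_
    · filter_upwards [eventually_gt_atTop 0] with c hc
      exact ((hUc (by positivity)).mono hsub).aestronglyMeasurable measurableSet_ball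
    · filter_upwards [eventually_ge_atTop 1] with c hc
      filter_upwards [ae_restrict_mem measurableSet_ball] with z hz
      have hwz := hw0 z (hsub hz)
      rw [Real.norm_of_nonneg (mul_nonneg hwz (le_max_left _ _))]
      gcongr
      exact smoothLog_le_of_le (by positivity) (inv_le_one_of_one_le₀ (one_le_pow₀ hc)) z
    · exact (((hUc one_pos).mono (closedBall_subset_ball hr)).integrableOn_compact
        (isCompact_closedBall 0 r)).mono_set ball_subset_closedBall
    · filter_upwards [ae_restrict_mem measurableSet_ball] with z hz
      exact ((tendsto_max_zero_smoothLog (hgh z (hsub hz))).comp hτ0).const_mul _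
  refine le_of_tendsto_of_tendsto hleft (hright.const_mul _) ?_
  filter_upwards [eventually_gt_atTop 0] with c hc0
  have hτ : 0 < (c ^ 2)⁻¹ := by positivity
  obtain ⟨h1, h2⟩ := sum_integral_le_integral_smoothLog_mul_laplacian (T := T) (m := m) hψ hc hψ0
    (hsupp.trans hsub) hh hτ
  exact h2.trans (integral_smoothLog_mul_laplacian_le hr hr₀ hC hb hB hsupp hw hw0 hwb hΔ hΔ0 hg
    hg0 hh hgh hτ h1)

/-! ### The weighted count of zeros of the dilated functions -/

section Weight

variable {n : ℕ} {η : Fin n → ℂ}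

theorem mul_sub_ne_zero (hη : ∀ j, ‖η j‖ = 1) {s : ℝ} (hs : s ∈ Icc (0 : ℝ) 1) {z : ℂ}
    (hz : z ∈ ball (0 : ℂ) 1) (j : Fin n) : (s : ℂ) * z - η j ≠ 0 := by
  rw [mem_ball_zero_iff] at hz
  intro h
  have h1 : ‖(s : ℂ) * z‖ = 1 := by rw [sub_eq_zero.1 h, hη]
  rw [norm_mul, Complex.norm_real, Real.norm_eq_abs, abs_of_nonneg hs.1] at h1
  nlinarith [norm_nonneg z, hs.2]

theorem continuousOn_weight (p : ℝ) (hη : ∀ j, ‖η j‖ = 1) (q : Fin n → ℝ) :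
    ContinuousOn (fun x : ℝ × ℂ => (1 - ‖x.2‖ ^ 2) ^ (p - 1) * ‖R η q (x.1 * x.2)‖ ^ 2)
      (Icc 0 1 ×ˢ ball 0 1) := by
  simp only [norm_R]
  refine ContinuousOn.mul ?_ (ContinuousOn.pow (continuousOn_finsetProd _ fun j _ => ?_) 2)
  · refine ContinuousOn.rpow_const (by fun_prop) fun x hx => Or.inl ?_
    have : ‖x.2‖ < 1 := by simpa using hx.2
    nlinarith [norm_nonneg x.2]
  · refine ContinuousOn.rpow_const (by fun_prop) fun x hx => Or.inl ?_
    exact norm_ne_zero_iff.2 (mul_sub_ne_zero hη hx.1 hx.2 j)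

theorem weight_pos (p : ℝ) (hη : ∀ j, ‖η j‖ = 1) (q : Fin n → ℝ) {s : ℝ}
    (hs : s ∈ Icc (0 : ℝ) 1) {z : ℂ} (hz : z ∈ ball (0 : ℂ) 1) :
    0 < (1 - ‖z‖ ^ 2) ^ (p - 1) * ‖R η q (s * z)‖ ^ 2 := by
  have h1 : 0 < ‖R η q (s * z)‖ := by
    rw [norm_R]
    exact Finset.prod_pos fun j _ =>
      Real.rpow_pos_of_pos (norm_pos_iff.2 (mul_sub_ne_zero hη hs hz j)) _
  have h2 : 0 < 1 - ‖z‖ ^ 2 := by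
    rw [mem_ball_zero_iff] at hz
    nlinarith [norm_nonneg z]
  have := Real.rpow_pos_of_pos h2 (p - 1)
  positivity

/-- On a smaller disc the weights are bounded above and below, uniformly in the dilation. -/
theorem exists_weight_bounds (p : ℝ) (hη : ∀ j, ‖η j‖ = 1) (q : Fin n → ℝ) {r₀ : ℝ}
    (hr₀ : r₀ ∈ Ico (0 : ℝ) 1) :
    ∃ b B : ℝ, 0 < b ∧ 0 ≤ B ∧ ∀ s ∈ Icc (0 : ℝ) 1, ∀ z ∈ ball (0 : ℂ) r₀,
      b ≤ (1 - ‖z‖ ^ 2) ^ (p - 1) * ‖R η q (s * z)‖ ^ 2 ∧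
      (1 - ‖z‖ ^ 2) ^ (p - 1) * ‖R η q (s * z)‖ ^ 2 ≤ B := by
  have hcpt : IsCompact (Icc (0 : ℝ) 1 ×ˢ closedBall (0 : ℂ) r₀) :=
    isCompact_Icc.prod (isCompact_closedBall 0 r₀)
  set F : ℝ × ℂ → ℝ := fun x => (1 - ‖x.2‖ ^ 2) ^ (p - 1) * ‖R η q (x.1 * x.2)‖ ^ 2 with hF
  have hcont : ContinuousOn F (Icc (0 : ℝ) 1 ×ˢ closedBall (0 : ℂ) r₀) :=
    (continuousOn_weight p hη q).mono (prod_mono_right (closedBall_subset_ball hr₀.2))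
  have hpos : ∀ x ∈ Icc (0 : ℝ) 1 ×ˢ closedBall (0 : ℂ) r₀, 0 < F x := fun x hx =>
    weight_pos p hη q hx.1 (closedBall_subset_ball hr₀.2 hx.2)
  have hne : (Icc (0 : ℝ) 1 ×ˢ closedBall (0 : ℂ) r₀).Nonempty :=
    ⟨(0, 0), left_mem_Icc.2 zero_le_one, mem_closedBall_self hr₀.1⟩
  obtain ⟨x, hx, hxmin⟩ := hcpt.exists_isMinOn hne hcont
  obtain ⟨y, hy, hymax⟩ := hcpt.exists_isMaxOn hne hcont
  refine ⟨F x, F y, hpos x hx, (hpos y hy).le, fun s hs z hz => ?_⟩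
  have hmem : (s, z) ∈ Icc (0 : ℝ) 1 ×ˢ closedBall (0 : ℂ) r₀ := ⟨hs, ball_subset_closedBall hz⟩
  exact ⟨isMinOn_iff.1 hxmin (s, z) hmem, isMaxOn_iff.1 hymax (s, z) hmem⟩

end Weight

/-- The weighted count of zeros for the dilation of `f` by `s < 1`, with a constant that depends
neither on `s` nor on the truncation `ε`. -/
theorem exists_sum_testFun_le {p : ℝ} (hp : 0 < p) {n : ℕ} {η : Fin n → ℂ}
    (hη : ∀ j, ‖η j‖ = 1) (hinj : Function.Injective η) {q : Fin n → ℝ}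
    (hq : ∀ j, -p / 4 < q j) :
    ∃ c : ℝ, 0 ≤ c ∧ ∀ s ∈ Ioo (0 : ℝ) 1, ∀ ε ∈ Ioo (0 : ℝ) 1, ∀ f : ℂ → ℂ,
      DifferentiableOn ℂ f (ball 0 1) → ‖f 0‖ = 1 → ∀ T : Finset ℂ, (∀ a ∈ T, a ∈ ball (0 : ℂ) 1) →
      ENNReal.ofReal (∑ a ∈ T, analyticOrderNatAt f (s * a) * testFun η q p ε s a) ≤
        ENNReal.ofReal c * ∫⁻ z in ball (0 : ℂ) 1, ENNReal.ofReal
          ((1 - ‖z‖ ^ 2) ^ (p - 1) * ‖R η q (s * z)‖ ^ 2 * Real.posLog ‖f (s * z)‖) := by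
  obtain ⟨C, hC, t₀, ht₀, hbd⟩ := exists_laplacian_testFun_bounds q hp hη hinj hq
  obtain ⟨K, hK, hKlim⟩ := exists_tendsto_integral_laplacian_log
  -- the Laplacian of the test function is nonnegative for `r₀ ≤ |z|`
  set r₀ := √(1 - t₀) with hr₀
  have hr₀2 : r₀ ^ 2 = 1 - t₀ := Real.sq_sqrt (by linarith [ht₀.2])
  have hr₀0 : 0 ≤ r₀ := Real.sqrt_nonneg _
  have hr₀1 : r₀ < 1 := by nlinarith [ht₀.1]
  obtain ⟨b, B, hb, hB, hwb⟩ := exists_weight_bounds p hη q ⟨hr₀0, hr₀1⟩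
  refine ⟨K⁻¹ * (C * (1 + B / b) * 2), by positivity, ?_⟩
  intro s hs ε hε f hf hf0 T hT
  have hs' : s ∈ Icc (0 : ℝ) 1 := Ioo_subset_Icc_self hs
  -- a disc which contains both the support of the test function and the disc of radius `r₀`
  set r := √(1 - min t₀ ε / 2) with hrdef
  have hmin0 : 0 < min t₀ ε := lt_min ht₀.1 hε.1
  have hmint : min t₀ ε ≤ t₀ := min_le_left _ _
  have hminε : min t₀ ε ≤ ε := min_le_right _ _
  have hr2 : r ^ 2 = 1 - min t₀ ε / 2 := Real.sq_sqrt (by linarith [ht₀.2])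
  have hr0 : 0 ≤ r := Real.sqrt_nonneg _
  have hr1 : r < 1 := by nlinarith
  have hrr₀ : r₀ ≤ r := Real.sqrt_le_sqrt (by linarith)
  have hsub : ball (0 : ℂ) r ⊆ ball 0 1 := ball_subset_ball hr1.le
  set w : ℂ → ℝ := fun z => (1 - ‖z‖ ^ 2) ^ (p - 1) * ‖R η q (s * z)‖ ^ 2 with hw
  have hwc : ContinuousOn w (ball 0 1) :=
    (continuousOn_weight p hη q).comp (f := fun z : ℂ => (s, z)) (by fun_prop)
      fun z hz => ⟨hs', hz⟩
  have hw0 : ∀ z ∈ ball (0 : ℂ) 1, 0 ≤ w z := fun z hz => (weight_pos p hη q hs' hz).le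
  have hmaps : MapsTo (fun z : ℂ => (s : ℂ) * z) (ball 0 1) (ball 0 1) := by
    intro z hz
    rw [mem_ball_zero_iff] at hz ⊢
    rw [norm_mul, Complex.norm_real, Real.norm_eq_abs, abs_of_pos hs.1]
    nlinarith [norm_nonneg z, hs.2]
  have hg : DifferentiableOn ℂ (fun z => f (s * z)) (ball 0 1) :=
    hf.comp (by fun_prop) hmaps
  have hord : ∀ a ∈ T, a ∈ ball (0 : ℂ) 1 ∧
      (analyticOrderNatAt f (s * a) : ℕ∞) ≤ analyticOrderAt (fun z => f (s * z)) a := by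
    intro a ha
    refine ⟨hT a ha, ?_⟩
    have hder : deriv (fun z : ℂ => (s : ℂ) * z) a ≠ 0 := by
      rw [((hasDerivAt_id' a).const_mul (s : ℂ)).deriv, mul_one]
      exact_mod_cast hs.1.ne'
    have := analyticOrderAt_comp_of_deriv_ne_zero (f := f) (g := fun z : ℂ => (s : ℂ) * z) (z₀ := a)
      (by fun_prop) hder
    rw [show (fun z => f (s * z)) = f ∘ fun z : ℂ => (s : ℂ) * z from rfl, this]
    exact ENat.natCast_toNat_le_self _
  have hsupp : tsupport (testFun η q p ε s) ⊆ ball 0 r := by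
    intro z hz
    have h1 : ε ≤ 1 - ‖z‖ ^ 2 := tsupport_testFun_subset q hz
    rw [mem_ball_zero_iff]
    nlinarith [norm_nonneg z]
  have main := sum_mul_le_integral_posLog hKlim (contDiff_testFun q hη hs hε.1)
    (hasCompactSupport_testFun q hε.1) (testFun_nonneg q hp hε.1) hr1 hrr₀ hC.le hb hB hsupp hwc hw0
    (fun z hz => hwb s hs' z hz)
    (fun z hz => (hbd s hs ε hε.1 z (by simpa using hsub hz)).1)
    (fun z hz hz0 => (hbd s hs ε hε.1 z (by simpa using hsub hz)).2 (by nlinarith))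
    hg (by simpa using hf0) hord
  have hF0 : ∀ z ∈ ball (0 : ℂ) 1, 0 ≤ w z * Real.posLog ‖f (s * z)‖ := fun z hz =>
    mul_nonneg (hw0 z hz) Real.posLog_nonneg
  have hFi : IntegrableOn (fun z => w z * Real.posLog ‖f (s * z)‖) (ball 0 r) := by
    have : ContinuousOn (fun z => w z * Real.posLog ‖f (s * z)‖) (ball 0 1) :=
      hwc.mul (Real.continuous_posLog.comp_continuousOn hg.continuousOn.norm)
    exact ((this.mono (closedBall_subset_ball hr1)).integrableOn_compact
      (isCompact_closedBall 0 r)).mono_set ball_subset_closedBall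
  have hle : ∑ a ∈ T, analyticOrderNatAt f (s * a) * testFun η q p ε s a ≤
      K⁻¹ * (C * (1 + B / b) * 2) * ∫ z in ball 0 r, w z * Real.posLog ‖f (s * z)‖ := by
    have e1 : ∑ a ∈ T, (analyticOrderNatAt f (s * a) : ℝ) * (K * testFun η q p ε s a) =
        K * ∑ a ∈ T, analyticOrderNatAt f (s * a) * testFun η q p ε s a := by
      rw [Finset.mul_sum]
      exact Finset.sum_congr rfl fun a _ => by ring
    have e2 : ∫ z in ball 0 r, w z * (2 * Real.posLog ‖f (s * z)‖) =
        2 * ∫ z in ball 0 r, w z * Real.posLog ‖f (s * z)‖ := by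
      rw [← integral_const_mul]
      congr 1
      ext z
      ring
    rw [e1, e2, ← le_inv_mul_iff₀ hK] at main
    linarith
  refine (ENNReal.ofReal_le_ofReal hle).trans ?_
  rw [ENNReal.ofReal_mul (by positivity)]
  gcongr
  rw [ofReal_integral_eq_lintegral_ofReal hFi]
  · exact lintegral_mono_set hsub
  · filter_upwards [ae_restrict_mem measurableSet_ball] with z hz using hF0 z (hsub hz)

/-- The truncation `ε = 1 - s` and the dilation `s` are removed together: the zero `a` of `f` gives
the zero `a / s` of the dilated function. -/
theorem tendsto_profile {p : ℝ} {x : ℝ} (hx : x < 1) :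
    Tendsto (fun s : ℝ => profile p (1 - s) (1 - x / s ^ 2)) (𝓝[<] 1)
      (𝓝 ((1 - x) ^ (1 + p))) := by
  have hx0 : 0 < 1 - x := by linarith
  have hc : ContinuousAt (fun s : ℝ => profile p (1 - s) (1 - x / s ^ 2)) 1 := by
    have h1 : ContinuousAt (fun s : ℝ => 1 - x / s ^ 2) 1 :=
      continuousAt_const.sub (continuousAt_const.div (by fun_prop) (by norm_num))
    refine ContinuousAt.mul (ContinuousAt.pow (ContinuousAt.sup ?_ continuousAt_const) 3) ?_
    · exact h1.sub (by fun_prop)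
    · exact h1.rpow_const (Or.inl (by norm_num; linarith))
  have h := hc.tendsto.mono_left (nhdsWithin_le_nhds (s := Iio 1))
  convert! h using 2
  simp only [profile]
  norm_num
  rw [max_eq_left hx0.le, ← Real.rpow_natCast, ← Real.rpow_add hx0]
  congr 1
  push_cast
  ring

end GeneralisedNevanlinna

open MeasureTheory Filter Topology Set Metric GeneralisedNevanlinna in
theorem mainTheorem2 (p : ℝ) (hp : 0 < p) (n : ℕ) (η : Fin n → ℂ) (hη : ∀ j, ‖η j‖ = 1)
    (hinj : Function.Injective η) (q : Fin n → ℝ) (hq : ∀ j, -p / 4 < q j) :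
    ∃ c : ℝ≥0, ∀ f : ℂ → ℂ,
      f ∈ GeneralisedNevanlinna.nevClass (fun z => ‖GeneralisedNevanlinna.R η q z‖ ^ 2) p →
      ‖f 0‖ = 1 → ∀ δ ∈ Set.Ioo (0 : ℝ) 1,
        GeneralisedNevanlinna.zeroSum f
            (fun a => (1 - ‖a‖ ^ 2) ^ (1 + p) * ‖GeneralisedNevanlinna.R η q a‖ ^ 2) ≤
          (c : ℝ≥0∞) * GeneralisedNevanlinna.nevNorm
            (fun z => ‖GeneralisedNevanlinna.R η q z‖ ^ 2) p δ f := by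
  obtain ⟨c, hc, h⟩ := exists_sum_testFun_le hp hη hinj hq
  refine ⟨c.toNNReal, fun f hf hf0 δ hδ => ?_⟩
  rw [zeroSum, ENNReal.tsum_eq_iSup_sum]
  refine iSup_le fun T => ?_
  have hlim : Tendsto (fun s : ℝ => ∑ a ∈ T, (analyticOrderNatAt f a : ℝ≥0∞) *
      ENNReal.ofReal (profile p (1 - s) (1 - ‖(a : ℂ)‖ ^ 2 / s ^ 2) * ‖R η q a‖ ^ 2)) (𝓝[<] 1)
      (𝓝 (∑ a ∈ T, (analyticOrderNatAt f a : ℝ≥0∞) *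
        ENNReal.ofReal ((1 - ‖(a : ℂ)‖ ^ 2) ^ (1 + p) * ‖R η q a‖ ^ 2))) := by
    refine tendsto_finsetSum _ fun a _ => ENNReal.Tendsto.const_mul
      (ENNReal.tendsto_ofReal ((tendsto_profile ?_).mul_const _))
      (Or.inr (ENNReal.natCast_ne_top _))
    have : ‖(a : ℂ)‖ < 1 := by simpa using a.2.1
    nlinarith [norm_nonneg (a : ℂ)]
  refine le_of_tendsto hlim ?_
  have hT : ∀ᶠ s : ℝ in 𝓝[<] 1, ∀ a ∈ T, ‖(a : ℂ)‖ < s := by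
    refine (Finset.eventually_all T).2 fun a _ => nhdsWithin_le_nhds (lt_mem_nhds ?_)
    simpa using a.2.1
  filter_upwards [hT, Ioo_mem_nhdsLT (show 1 - δ < 1 by linarith [hδ.1])] with s hTs hs
  have hs0 : 0 < s := by linarith [hs.1, hδ.2]
  have hsC : (s : ℂ) ≠ 0 := by exact_mod_cast hs0.ne'
  let e : zeros f ↪ ℂ := ⟨fun a => (a : ℂ) / s, fun a b hab =>
    Subtype.ext ((div_left_inj' hsC).1 hab)⟩
  have he : ∀ a : zeros f, e a = (a : ℂ) / s := fun _ => rfl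
  have key := h s ⟨hs0, hs.2⟩ (1 - s) ⟨by linarith [hs.2], by linarith⟩ f hf.1 hf0
    (T.map e) (by
      intro a ha
      obtain ⟨a, haT, rfl⟩ := Finset.mem_map.1 ha
      rw [he, mem_ball_zero_iff, norm_div, Complex.norm_real, Real.norm_eq_abs, abs_of_pos hs0,
        div_lt_one hs0]
      exact hTs a haT)
  rw [Finset.sum_map] at key
  simp only [he, mul_div_cancel₀ _ hsC, testFun, norm_div,
    Complex.norm_real, Real.norm_eq_abs, abs_of_pos hs0, div_pow] at key
  rw [ENNReal.ofReal_sum_of_nonneg] at key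
  · simp only [ENNReal.ofReal_mul (Nat.cast_nonneg _), ENNReal.ofReal_natCast] at key
    refine key.trans ?_
    rw [ENNReal.ofReal]
    gcongr
    exact le_iSup₂ (f := fun s (_ : s ∈ Ioo (1 - δ) 1) => ∫⁻ z in ball (0 : ℂ) 1,
      ENNReal.ofReal ((1 - ‖z‖ ^ 2) ^ (p - 1) * ‖R η q (s * z)‖ ^ 2 * Real.posLog ‖f (s * z)‖))
      s hs
  · intro a ha
    have := testFun_nonneg (η := η) (s := s) q hp (sub_pos.2 hs.2) ((a : ℂ) / s)
    simp only [testFun, mul_div_cancel₀ _ hsC, norm_div, Complex.norm_real, Real.norm_eq_abs,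
      abs_of_pos hs0, div_pow] at this
    exact mul_nonneg (Nat.cast_nonneg _) this
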